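/- Let $k$ be a field. All operads are symmetric operads in $k$-vector spaces, and $I$ denotes the identity operation; for binary operations $x,y$, the ternary operations $x\circ(y,I)$ and $x\circ(I,y)$ are $(a_1,a_2,a_3)\mapsto x(y(a_1,a_2),a_3)$ and $(a_1,a_2,a_3)\mapsto x(a_1,y(a_2,a_3))$. Let $\mathcal P_\nearrow$ be the quadratic operad generated by two binary operations $m$ and $\nearrow$ (i.e. by the $S_2$-module $E$ freely generated by $m$ and $\nearrow$), with the relations $$\nearrow\circ(\nearrow,I)=\nearrow\circ(I,\nearrow),\qquad \nearrow\circ(I,m)=m\circ(\nearrow,I),\qquad m\circ(m,I)=m\circ(I,m).$$ Let $\mathcal H=\mathcal P_\nearrow^!$ be its Koszul dual: writing $\mathcal P(E)$ for the free operad on $E$ and $\mathcal P_\nearrow=\mathcal P(E)/(R)$ with $R\subseteq \mathcal P(E)(3)$ the $S_3$-submodule generated by the relations, $\mathcal H=\mathcal P(E^\vee)/(R^\perp)$, where $E^\vee=E^*\otimes\mathrm{sgn}_2$ and $R^\perp\subseteq\mathcal P(E^\vee)(3)$ is the orthogonal of $R$ for the canonical ($\mathrm{sgn}_3$-twisted invariant)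 pairing between $\mathcal P(E^\vee)(3)$ and $\mathcal P(E)(3)$. **Theorem.** The operad $\mathcal H$ is generated by two binary operations $m,\nearrow\in\mathcal H(2)$ with the relations $$\begin{aligned} \nearrow\circ(\nearrow,I)&=\nearrow\circ(I,\nearrow),\\ m\circ(m,I)&=m\circ(I,m),\\ m\circ(\nearrow,I)&=\nearrow\circ(I,m),\\ \nearrow\circ(m,I)&=0,\\ m\circ(I,\nearrow)&=0. \end{aligned}$$ That is, there is an isomorphism of operads onto $\mathcal H$ from the operad presented by two binary generators $m,\nearrow$ (generating a free $S_2$-module) and these relations; it sends $m$ and $\nearrow$ to the classes of the elements $m^\vee,\nearrow^\vee\in E^\vee$ of the basis dual to the basis of $E$ formed by $m$, $\nearrow$ and their images under the transposition of $S_2$. -/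

import Mathlib

open scoped TensorProduct

universe u

namespace Operads

/-! ### Symmetric operads

A symmetric operad in vector spaces over `k`, in coordinate-free form: there is a space `obj A` of
operations for every finite set `A` of inputs, and bijections of inputs act. With `A = Fin n` one
gets the space of `n`-ary operations with its `S_n`-action; `comp p q` is the total composition
that plugs the operation `q a` into the input `a` of `p`. -/

/-- A symmetric operad (with unit) in `k`-vector spaces, indexed by finite sets of inputs. -/
structure Operad (k : Type u) [Field k] where
  /-- The space of operations with set of inputs `A`. -/
  obj : (A : Type) → [Finite A] → Type u
  [addCommGroup : ∀ (A : Type) [Finite A], AddCommGroup (obj A)]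
  [module : ∀ (A : Type) [Finite A], Module k (obj A)]
  /-- The action of bijections. -/
  relabel : ∀ {A B : Type} [Finite A] [Finite B], (A ≃ B) → obj A →ₗ[k] obj B
  /-- The identity operation `I`. -/
  one : obj (Fin 1)
  /-- Total composition. -/
  comp : ∀ {A : Type} {B : A → Type} [Finite A] [∀ a, Finite (B a)],
    obj A →ₗ[k] MultilinearMap k (fun a => obj (B a)) (obj (Σ a, B a))
  relabel_refl : ∀ {A : Type} [Finite A] (p : obj A), relabel (Equiv.refl A) p = p
  relabel_trans : ∀ {A B C : Type} [Finite A] [Finite B] [Finite C] (σ : A ≃ B) (τ : B ≃ C)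
    (p : obj A), relabel (σ.trans τ) p = relabel τ (relabel σ p)
  comp_relabel_left : ∀ {A A' : Type} {B : A' → Type} [Finite A] [Finite A']
    [∀ a, Finite (B a)] (σ : A ≃ A') (p : obj A) (q : ∀ a, obj (B a)),
    comp (relabel σ p) q
      = relabel (Equiv.sigmaCongrLeft σ) (comp (B := fun a => B (σ a)) p (fun a => q (σ a)))
  comp_relabel_right : ∀ {A : Type} {B B' : A → Type} [Finite A] [∀ a, Finite (B a)]
    [∀ a, Finite (B' a)] (τ : ∀ a, B a ≃ B' a) (p : obj A) (q : ∀ a, obj (B a)),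
    comp p (fun a => relabel (τ a) (q a)) = relabel (Equiv.sigmaCongrRight τ) (comp p q)
  one_comp : ∀ {A : Type} [Finite A] (p : obj A),
    relabel (Equiv.uniqueSigma (fun _ : Fin 1 => A)) (comp one (fun _ => p)) = p
  comp_one : ∀ {A : Type} [Finite A] (p : obj A),
    relabel (Equiv.sigmaUnique A (fun _ => Fin 1)) (comp p (fun _ => one)) = p
  comp_assoc : ∀ {A : Type} {B : A → Type} {C : ∀ a, B a → Type} [Finite A]
    [∀ a, Finite (B a)] [∀ a b, Finite (C a b)] (p : obj A) (q : ∀ a, obj (B a))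
    (r : ∀ a b, obj (C a b)),
    relabel (Equiv.sigmaAssoc C)
        (comp (B := fun x : Σ a, B a => C x.1 x.2) (comp p q) (fun x => r x.1 x.2))
      = comp p (fun a => comp (q a) (r a))

attribute [instance] Operad.addCommGroup Operad.module

/-- Morphisms of operads. -/
structure Operad.Hom {k : Type u} [Field k] (P Q : Operad k) where
  toFun : ∀ (A : Type) [Finite A], P.obj A →ₗ[k] Q.obj A
  map_relabel : ∀ {A B : Type} [Finite A] [Finite B] (σ : A ≃ B) (p : P.obj A),
    toFun B (P.relabel σ p) = Q.relabel σ (toFun A p)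
  map_one : toFun (Fin 1) P.one = Q.one
  map_comp : ∀ {A : Type} {B : A → Type} [Finite A] [∀ a, Finite (B a)] (p : P.obj A)
    (q : ∀ a, P.obj (B a)),
    toFun (Σ a, B a) (P.comp p q) = Q.comp (toFun A p) (fun a => toFun (B a) (q a))

/-- A morphism of operads is an isomorphism when it is bijective in every arity. -/
def Operad.Hom.IsIso {k : Type u} [Field k] {P Q : Operad k} (Φ : P.Hom Q) : Prop :=
  ∀ (A : Type) [Finite A], Function.Bijective (Φ.toFun A)

/-- The substitution `x ∘ (y, I)` of binary operations, that is
`(a₀, a₁, a₂) ↦ x (y (a₀, a₁), a₂)`. -/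
noncomputable def Operad.compLeft {k : Type u} [Field k] (P : Operad k)
    (x y : P.obj (Fin 2)) : P.obj (Fin 3) :=
  let n : Fin 2 → ℕ := ![2, 1]
  P.relabel (finSigmaFinEquiv.trans (finCongr (by decide : ∑ i, n i = 3)))
    (P.comp (B := fun i => Fin (n i)) x fun
      | 0 => y
      | 1 => P.one)

/-- The substitution `x ∘ (I, y)` of binary operations, that is
`(a₀, a₁, a₂) ↦ x (a₀, y (a₁, a₂))`. -/
noncomputable def Operad.compRight {k : Type u} [Field k] (P : Operad k)
    (x y : P.obj (Fin 2)) : P.obj (Fin 3) :=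
  let n : Fin 2 → ℕ := ![1, 2]
  P.relabel (finSigmaFinEquiv.trans (finCongr (by decide : ∑ i, n i = 3)))
    (P.comp (B := fun i => Fin (n i)) x fun
      | 0 => P.one
      | 1 => y)

/-! ### Operadic ideals and quotients -/

/-- Operadic ideals: families of subspaces stable under bijections and under composition with
arbitrary operations on either side. -/
structure Operad.Ideal {k : Type u} [Field k] (P : Operad k) where
  carrier : ∀ (A : Type) [Finite A], Submodule k (P.obj A)
  relabel_mem : ∀ {A B : Type} [Finite A] [Finite B] (σ : A ≃ B) {p : P.obj A},
    p ∈ carrier A → P.relabel σ p ∈ carrier B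
  comp_mem_left : ∀ {A : Type} {B : A → Type} [Finite A] [∀ a, Finite (B a)] {p : P.obj A}
    (q : ∀ a, P.obj (B a)), p ∈ carrier A → P.comp p q ∈ carrier (Σ a, B a)
  comp_mem_right : ∀ {A : Type} {B : A → Type} [Finite A] [∀ a, Finite (B a)] (p : P.obj A)
    {q : ∀ a, P.obj (B a)} (a : A), q a ∈ carrier (B a) → P.comp p q ∈ carrier (Σ a, B a)

/-- The smallest operadic ideal containing a given set of ternary operations. -/
def Operad.idealSpan {k : Type u} [Field k] (P : Operad k) (S : Set (P.obj (Fin 3))) :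
    P.Ideal where
  carrier A _ := ⨅ J : {J : P.Ideal // S ⊆ J.carrier (Fin 3)}, J.1.carrier A
  relabel_mem σ p hp := by
    rw [Submodule.mem_iInf] at hp ⊢
    exact fun J => J.1.relabel_mem σ (hp J)
  comp_mem_left q hp := by
    rw [Submodule.mem_iInf] at hp ⊢
    exact fun J => J.1.comp_mem_left q (hp J)
  comp_mem_right p q a hq := by
    rw [Submodule.mem_iInf] at hq ⊢
    exact fun J => J.1.comp_mem_right p a (hq J)

namespace Operad.Ideal

variable {k : Type u} [Field k] {P : Operad k} (J : P.Ideal)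

theorem comp_sub_mem {A : Type} {B : A → Type} [Finite A] [∀ a, Finite (B a)] (p : P.obj A)
    (q q' : ∀ a, P.obj (B a)) (h : ∀ a, q a - q' a ∈ J.carrier (B a)) :
    P.comp p q - P.comp p q' ∈ J.carrier (Σ a, B a) := by
  classical
  have := Fintype.ofFinite A
  have key : ∀ s : Finset A,
      P.comp p (fun a => if a ∈ s then q a else q' a) - P.comp p q' ∈ J.carrier (Σ a, B a) := by
    intro s
    induction s using Finset.induction_on with
    | empty => simp
    | insert b s hb ih =>
      have e1 : (fun a => if a ∈ insert b s then q a else q' a)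
          = Function.update (fun a => if a ∈ s then q a else q' a) b
            ((q b - q' b) + q' b) := by
        funext a
        by_cases hab : a = b
        · subst hab; simp
        · simp [hab]
      have e2 : Function.update (fun a => if a ∈ s then q a else q' a) b (q' b)
          = (fun a => if a ∈ s then q a else q' a) := by
        funext a
        by_cases hab : a = b
        · subst hab; simp [hb]
        · simp [hab]
      rw [e1, MultilinearMap.map_update_add, e2, add_sub_assoc]
      exact add_mem (J.comp_mem_right p b (by simpa using h b)) ih
  simpa using key Finset.univ

theorem mk_comp_eq {A : Type} {B : A → Type} [Finite A] [∀ a, Finite (B a)] {p p' : P.obj A}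
    {q q' : ∀ a, P.obj (B a)} (hp : (J.carrier A).mkQ p = (J.carrier A).mkQ p')
    (h : ∀ a, (J.carrier (B a)).mkQ (q a) = (J.carrier (B a)).mkQ (q' a)) :
    (J.carrier (Σ a, B a)).mkQ (P.comp p q) = (J.carrier (Σ a, B a)).mkQ (P.comp p' q') := by
  simp only [Submodule.mkQ_apply, Submodule.Quotient.eq] at hp h ⊢
  have h1 := J.comp_sub_mem p q q' h
  have h2 := J.comp_mem_left q' hp
  rw [map_sub, sub_apply] at h2
  simpa using add_mem h1 h2

theorem mkQ_out {A : Type} [Finite A] (x : P.obj A ⧸ J.carrier A) :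
    (J.carrier A).mkQ x.out = x := Quotient.out_eq x

/-- Composition in the quotient; see `quotComp_mk`. -/
noncomputable def quotComp {A : Type} {B : A → Type} [Finite A] [∀ a, Finite (B a)] :
    (P.obj A ⧸ J.carrier A) →ₗ[k]
      MultilinearMap k (fun a => P.obj (B a) ⧸ J.carrier (B a))
        (P.obj (Σ a, B a) ⧸ J.carrier (Σ a, B a)) where
  toFun p :=
    { toFun := fun q => (J.carrier _).mkQ (P.comp p.out (fun a => (q a).out))
      map_update_add' := by
        intro _ q a x y
        have e : ∀ z : P.obj (B a), (J.carrier _).mkQ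
            (P.comp p.out (fun b => (Function.update q a ((J.carrier (B a)).mkQ z) b).out))
            = (J.carrier _).mkQ (P.comp p.out (Function.update (fun b => (q b).out) a z)) := by
          intro z
          refine J.mk_comp_eq rfl fun b => ?_
          rw [J.mkQ_out]
          by_cases hb : b = a
          · subst hb; simp
          · simp only [Function.update_of_ne hb]; exact (J.mkQ_out _).symm
        have h := e (x.out + y.out)
        rw [MultilinearMap.map_update_add, map_add, map_add, ← e, ← e] at h
        simpa only [J.mkQ_out] using h
      map_update_smul' := by
        intro _ q a c x
        have e : ∀ z : P.obj (B a), (J.carrier _).mkQ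
            (P.comp p.out (fun b => (Function.update q a ((J.carrier (B a)).mkQ z) b).out))
            = (J.carrier _).mkQ (P.comp p.out (Function.update (fun b => (q b).out) a z)) := by
          intro z
          refine J.mk_comp_eq rfl fun b => ?_
          rw [J.mkQ_out]
          by_cases hb : b = a
          · subst hb; simp
          · simp only [Function.update_of_ne hb]; exact (J.mkQ_out _).symm
        have h := e (c • x.out)
        rw [MultilinearMap.map_update_smul, map_smul, map_smul, ← e] at h
        simpa only [J.mkQ_out] using h }
  map_add' p p' := by
    ext q
    change (J.carrier _).mkQ _ = (J.carrier _).mkQ _ + (J.carrier _).mkQ _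
    rw [← map_add, ← add_apply, ← map_add]
    refine J.mk_comp_eq ?_ fun _ => rfl
    rw [map_add, J.mkQ_out, J.mkQ_out, J.mkQ_out]
  map_smul' c p := by
    ext q
    change (J.carrier _).mkQ _ = c • (J.carrier _).mkQ _
    rw [← map_smul, ← smul_apply, ← map_smul]
    refine J.mk_comp_eq ?_ fun _ => rfl
    rw [map_smul, J.mkQ_out, J.mkQ_out]

theorem quotComp_mk {A : Type} {B : A → Type} [Finite A] [∀ a, Finite (B a)] (p : P.obj A)
    (q : ∀ a, P.obj (B a)) :
    J.quotComp ((J.carrier A).mkQ p) (fun a => (J.carrier (B a)).mkQ (q a))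
      = (J.carrier (Σ a, B a)).mkQ (P.comp p q) :=
  J.mk_comp_eq (J.mkQ_out _) fun _ => J.mkQ_out _

theorem exists_lift {A : Type} {B : A → Type} [∀ a, Finite (B a)]
    (q : ∀ a, P.obj (B a) ⧸ J.carrier (B a)) :
    ∃ q' : ∀ a, P.obj (B a), q = fun a => (J.carrier (B a)).mkQ (q' a) :=
  ⟨fun a => (q a).out, funext fun a => (J.mkQ_out (q a)).symm⟩

end Operad.Ideal

/-- The quotient of an operad by an operadic ideal. -/
noncomputable def Operad.quotient {k : Type u} [Field k] (P : Operad k) (J : P.Ideal) :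
    Operad k where
  obj A _ := P.obj A ⧸ J.carrier A
  relabel {A B} _ _ σ := (J.carrier A).mapQ (J.carrier B) (P.relabel σ)
    (fun _ hp => J.relabel_mem σ hp)
  one := (J.carrier (Fin 1)).mkQ P.one
  comp := J.quotComp
  relabel_refl p := by
    obtain ⟨p, rfl⟩ := Submodule.mkQ_surjective _ p
    simp [P.relabel_refl]
  relabel_trans σ τ p := by
    obtain ⟨p, rfl⟩ := Submodule.mkQ_surjective _ p
    simp [P.relabel_trans]
  comp_relabel_left σ p q := by
    obtain ⟨p, rfl⟩ := Submodule.mkQ_surjective _ p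
    obtain ⟨q, rfl⟩ := J.exists_lift q
    simp only [Submodule.mkQ_apply, Submodule.mapQ_apply]
    simp only [← Submodule.mkQ_apply]
    rw [J.quotComp_mk, P.comp_relabel_left, J.quotComp_mk (B := fun a => _) p (fun a => q (σ a))]
    simp only [Submodule.mkQ_apply, Submodule.mapQ_apply]
  comp_relabel_right τ p q := by
    obtain ⟨p, rfl⟩ := Submodule.mkQ_surjective _ p
    obtain ⟨q, rfl⟩ := J.exists_lift q
    simp only [Submodule.mkQ_apply, Submodule.mapQ_apply]
    simp only [← Submodule.mkQ_apply]
    rw [J.quotComp_mk, J.quotComp_mk, P.comp_relabel_right]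
    simp only [Submodule.mkQ_apply, Submodule.mapQ_apply]
  one_comp p := by
    obtain ⟨p, rfl⟩ := Submodule.mkQ_surjective _ p
    rw [J.quotComp_mk]
    simp only [Submodule.mkQ_apply, Submodule.mapQ_apply, P.one_comp]
  comp_one p := by
    obtain ⟨p, rfl⟩ := Submodule.mkQ_surjective _ p
    rw [J.quotComp_mk]
    simp only [Submodule.mkQ_apply, Submodule.mapQ_apply, P.comp_one]
  comp_assoc {A B C} _ _ _ p q r := by
    obtain ⟨p, rfl⟩ := Submodule.mkQ_surjective _ p
    obtain ⟨q, rfl⟩ := J.exists_lift q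
    have hr : ∃ r' : ∀ a b, P.obj (C a b), r = fun a b => (J.carrier (C a b)).mkQ (r' a b) :=
      ⟨fun a b => (r a b).out, funext fun a => funext fun b => (J.mkQ_out (r a b)).symm⟩
    obtain ⟨r, rfl⟩ := hr
    simp only [J.quotComp_mk]
    simp only [Submodule.mkQ_apply, Submodule.mapQ_apply, P.comp_assoc]

/-! ### The free operad on an `S₂`-module of binary operations

The free operad on `E` is realized as the multilinear part of free algebras: `FreeAlg ρ X` is the
free algebra on the set `X` with bilinear operations indexed linearly by `E`, subject to
`(τ e) (x, y) = e (y, x)` for the transposition `τ`, and the operations with set of inputs `A` are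
the elements of `FreeAlg ρ A` that are linear combinations of planar binary trees with vertices
decorated by `E`, in which every `a ∈ A` labels exactly one leaf. -/

/-- The transposition in `S₂`. -/
abbrev tau : Equiv.Perm (Fin 2) := Equiv.swap 0 1

/-- Planar binary trees, vertices decorated by `E` and leaves labelled by `X`. -/
inductive Tree (E : Type u) (X : Type) : Type u
  | leaf (x : X) : Tree E X
  | node (e : E) (l r : Tree E X) : Tree E X

/-- The leaf labels of a tree, from left to right. -/
def Tree.leaves {E : Type u} {X : Type} : Tree E X → List X
  | leaf x => [x]
  | node _ l r => l.leaves ++ r.leaves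

/-- Every element of `X` labels exactly one leaf. -/
def Tree.IsMultilinear {E : Type u} {X : Type} (t : Tree E X) : Prop :=
  t.leaves.Nodup ∧ ∀ x, x ∈ t.leaves

section FreeAlg

variable {k : Type u} [Field k] {E : Type u} [AddCommGroup E] [Module k E]
  (ρ : Representation k (Equiv.Perm (Fin 2)) E)

/-- The relations between decorated trees: linearity and `S₂`-equivariance at every vertex. -/
inductive Rel (X : Type) : (Tree E X →₀ k) → Prop
  | add (e f : E) (l r : Tree E X) : Rel X (Finsupp.single (.node (e + f) l r) 1
      - Finsupp.single (.node e l r) 1 - Finsupp.single (.node f l r) 1)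
  | smul (c : k) (e : E) (l r : Tree E X) : Rel X (Finsupp.single (.node (c • e) l r) 1
      - c • Finsupp.single (.node e l r) 1)
  | symm (e : E) (l r : Tree E X) : Rel X (Finsupp.single (.node (ρ tau e) l r) 1
      - Finsupp.single (.node e r l) 1)
  | left (e : E) (r : Tree E X) {x : Tree E X →₀ k} :
      Rel X x → Rel X (x.mapDomain fun l => .node e l r)
  | right (e : E) (l : Tree E X) {x : Tree E X →₀ k} :
      Rel X x → Rel X (x.mapDomain fun r => .node e l r)

/-- The free algebra on `X` over the binary operations `E`. -/
def FreeAlg (X : Type) : Type u :=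
  (Tree E X →₀ k) ⧸ Submodule.span k {x | Rel ρ X x}

noncomputable instance (X : Type) : AddCommGroup (FreeAlg ρ X) :=
  inferInstanceAs (AddCommGroup ((Tree E X →₀ k) ⧸ Submodule.span k {x | Rel ρ X x}))

noncomputable instance (X : Type) : Module k (FreeAlg ρ X) :=
  inferInstanceAs (Module k ((Tree E X →₀ k) ⧸ Submodule.span k {x | Rel ρ X x}))

namespace FreeAlg

variable {X Y Z : Type}

/-- The projection from linear combinations of trees. -/
noncomputable def mk (X : Type) : (Tree E X →₀ k) →ₗ[k] FreeAlg ρ X :=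
  Submodule.mkQ _

/-- The class of a tree. -/
noncomputable def mon (t : Tree E X) : FreeAlg ρ X := mk ρ X (Finsupp.single t 1)

theorem mk_rel {x : Tree E X →₀ k} (h : Rel ρ X x) : mk ρ X x = 0 :=
  (Submodule.Quotient.mk_eq_zero _).2 (Submodule.subset_span h)

variable {ρ}

theorem mk_surjective : Function.Surjective (mk ρ X) := Submodule.mkQ_surjective _

theorem hom_ext {N : Type*} [AddCommGroup N] [Module k N] {f g : FreeAlg ρ X →ₗ[k] N}
    (h : ∀ t, f (mon ρ t) = g (mon ρ t)) : f = g := by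
  refine LinearMap.ext fun x => ?_
  obtain ⟨x, rfl⟩ := mk_surjective x
  have : f ∘ₗ mk ρ X = g ∘ₗ mk ρ X := by
    refine Finsupp.lhom_ext' fun t => LinearMap.ext_ring ?_
    exact h t
  exact LinearMap.congr_fun this x

variable (ρ)

/-- The linear map out of the free algebra with given values on trees. -/
noncomputable def desc {N : Type*} [AddCommGroup N] [Module k N] (g : Tree E X → N)
    (h : ∀ x, Rel ρ X x → Finsupp.linearCombination k g x = 0) : FreeAlg ρ X →ₗ[k] N :=
  Submodule.liftQ _ (Finsupp.linearCombination k g) (by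
    rw [Submodule.span_le]
    exact fun x hx => h x hx)

@[simp]
theorem desc_mon {N : Type*} [AddCommGroup N] [Module k N] (g : Tree E X → N)
    (h : ∀ x, Rel ρ X x → Finsupp.linearCombination k g x = 0) (t : Tree E X) :
    desc ρ g h (mon ρ t) = g t := by
  change Finsupp.linearCombination k g (Finsupp.single t 1) = g t
  simp

theorem mk_eq_linearCombination (x : Tree E X →₀ k) :
    mk ρ X x = Finsupp.linearCombination k (mon ρ) x := by
  have : mk ρ X = Finsupp.linearCombination k (mon ρ) := by
    refine Finsupp.lhom_ext' fun t => LinearMap.ext_ring ?_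
    simp [mon]
  rw [this]

theorem mon_add (e f : E) (l r : Tree E X) :
    mon ρ (.node (e + f) l r) = mon ρ (.node e l r) + mon ρ (.node f l r) := by
  have := mk_rel ρ (Rel.add e f l r)
  rw [map_sub, map_sub, sub_sub, sub_eq_zero] at this
  exact this

theorem mon_smul (c : k) (e : E) (l r : Tree E X) :
    mon ρ (.node (c • e) l r) = c • mon ρ (.node e l r) := by
  have := mk_rel ρ (Rel.smul c e l r)
  rw [map_sub, map_smul, sub_eq_zero] at this
  exact this

theorem mon_symm (e : E) (l r : Tree E X) :
    mon ρ (.node (ρ tau e) l r) = mon ρ (.node e r l) := by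
  have := mk_rel ρ (Rel.symm e l r)
  rw [map_sub, sub_eq_zero] at this
  exact this

/-- The binary operations of the free algebra: `op e [l] [r]` is the class of the tree with root
`e` and subtrees `l`, `r`. -/
noncomputable def op : E →ₗ[k] FreeAlg ρ X →ₗ[k] FreeAlg ρ X →ₗ[k] FreeAlg ρ X where
  toFun e := desc ρ
    (fun l => desc ρ (fun r => mon ρ (.node e l r)) (fun x hx => by
      have := mk_rel ρ (Rel.right e l hx)
      rwa [mk_eq_linearCombination, Finsupp.linearCombination_mapDomain] at this))
    (fun x hx => by
      refine hom_ext fun r => ?_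
      have := mk_rel ρ (Rel.left e r hx)
      rw [mk_eq_linearCombination, Finsupp.linearCombination_mapDomain] at this
      rw [Finsupp.linearCombination_apply] at this ⊢
      rw [Finsupp.sum, LinearMap.sum_apply]
      simpa [Finsupp.sum] using this)
  map_add' e f := hom_ext fun l => hom_ext fun r => by simp [mon_add]
  map_smul' c e := hom_ext fun l => hom_ext fun r => by simp [mon_smul]

@[simp]
theorem op_mon (e : E) (l r : Tree E X) :
    op ρ e (mon ρ l) (mon ρ r) = mon ρ (.node e l r) := by
  simp [op]

theorem op_symm (e : E) (x y : FreeAlg ρ X) : op ρ (ρ tau e) x y = op ρ e y x := by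
  have : op (X := X) ρ (ρ tau e) = (op ρ e).flip :=
    hom_ext (X := X) fun l => hom_ext (X := X) fun r => by simp [mon_symm]
  rw [this, LinearMap.flip_apply]

/-- Evaluation of a tree in a free algebra. -/
noncomputable def evalTree (q : X → FreeAlg ρ Y) : Tree E X → FreeAlg ρ Y
  | .leaf x => q x
  | .node e l r => op ρ e (evalTree q l) (evalTree q r)

theorem evalTree_rel (q : X → FreeAlg ρ Y) (x : Tree E X →₀ k) (hx : Rel ρ X x) :
    Finsupp.linearCombination k (evalTree ρ q) x = 0 := by
  induction hx with
  | add e f l r => simp [evalTree]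
  | smul c e l r => simp [evalTree]
  | symm e l r => simp [evalTree, op_symm]
  | left e r h ih =>
    rw [Finsupp.linearCombination_mapDomain]
    have : (evalTree ρ q ∘ fun l => Tree.node e l r)
        = fun l => ((op ρ e).flip (evalTree ρ q r)) (evalTree ρ q l) := rfl
    rw [this]
    have h2 := congrArg ((op ρ e).flip (evalTree ρ q r)) ih
    rw [Finsupp.apply_linearCombination, map_zero] at h2
    exact h2
  | right e l h ih =>
    rw [Finsupp.linearCombination_mapDomain]
    have : (evalTree ρ q ∘ fun r => Tree.node e l r)
        = fun r => (op ρ e (evalTree ρ q l)) (evalTree ρ q r) := rfl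
    rw [this]
    have h2 := congrArg (op ρ e (evalTree ρ q l)) ih
    rw [Finsupp.apply_linearCombination, map_zero] at h2
    exact h2

/-- Substitution of `q x` for each generator `x`: the algebra morphism extending `q`. -/
noncomputable def subst (q : X → FreeAlg ρ Y) : FreeAlg ρ X →ₗ[k] FreeAlg ρ Y :=
  desc ρ (evalTree ρ q) (evalTree_rel ρ q)

@[simp]
theorem subst_mon (q : X → FreeAlg ρ Y) (t : Tree E X) :
    subst ρ q (mon ρ t) = evalTree ρ q t := desc_mon ..

theorem subst_op (q : X → FreeAlg ρ Y) (e : E) (x y : FreeAlg ρ X) :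
    subst ρ q (op ρ e x y) = op ρ e (subst ρ q x) (subst ρ q y) := by
  have : (op ρ e).compr₂ (subst ρ q) = (op ρ e).compl₁₂ (subst ρ q) (subst ρ q) :=
    hom_ext fun l => hom_ext fun r => by simp [evalTree]
  simpa using LinearMap.congr_fun (LinearMap.congr_fun this x) y

theorem subst_evalTree (p : X → FreeAlg ρ Y) (q : Y → FreeAlg ρ Z) (t : Tree E X) :
    subst ρ q (evalTree ρ p t) = evalTree ρ (fun x => subst ρ q (p x)) t := by
  induction t with
  | leaf x => rfl
  | node e l r hl hr => simp [evalTree, subst_op, hl, hr]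

theorem subst_subst (p : X → FreeAlg ρ Y) (q : Y → FreeAlg ρ Z) (x : FreeAlg ρ X) :
    subst ρ q (subst ρ p x) = subst ρ (fun x => subst ρ q (p x)) x := by
  have : subst ρ q ∘ₗ subst ρ p = subst ρ (fun x => subst ρ q (p x)) :=
    hom_ext fun t => by simp [subst_evalTree]
  exact LinearMap.congr_fun this x

theorem evalTree_leaf (t : Tree E X) : evalTree ρ (fun x => mon ρ (.leaf x)) t = mon ρ t := by
  induction t with
  | leaf x => rfl
  | node e l r hl hr => simp [evalTree, hl, hr]

theorem subst_leaf (x : FreeAlg ρ X) : subst ρ (fun x => mon ρ (.leaf x)) x = x := by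
  have : subst ρ (fun x : X => mon ρ (.leaf x)) = LinearMap.id :=
    hom_ext fun t => by simp [evalTree_leaf]
  exact LinearMap.congr_fun this x

/-- Renaming of the generators. -/
noncomputable def rename (f : X → Y) : FreeAlg ρ X →ₗ[k] FreeAlg ρ Y :=
  subst ρ (fun x => mon ρ (.leaf (f x)))

theorem subst_rename (f : X → Y) (q : Y → FreeAlg ρ Z) (x : FreeAlg ρ X) :
    subst ρ q (rename ρ f x) = subst ρ (fun x => q (f x)) x := by
  simp [rename, subst_subst, evalTree]

theorem rename_subst (p : X → FreeAlg ρ Y) (f : Y → Z) (x : FreeAlg ρ X) :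
    rename ρ f (subst ρ p x) = subst ρ (fun x => rename ρ f (p x)) x := by
  simp [rename, subst_subst]

theorem rename_rename (f : X → Y) (g : Y → Z) (x : FreeAlg ρ X) :
    rename ρ g (rename ρ f x) = rename ρ (fun x => g (f x)) x := by
  rw [rename, subst_rename]; rfl

theorem evalTree_congr {p q : X → FreeAlg ρ Y} {t : Tree E X} (h : ∀ x ∈ t.leaves, p x = q x) :
    evalTree ρ p t = evalTree ρ q t := by
  induction t with
  | leaf x => exact h x (by simp [Tree.leaves])
  | node e l r hl hr =>
    simp only [Tree.leaves, List.mem_append] at h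
    simp only [evalTree]
    rw [hl fun x hx => h x (.inl hx), hr fun x hx => h x (.inr hx)]

theorem evalTree_update_add [DecidableEq X] (q : X → FreeAlg ρ Y) (a : X) (u v : FreeAlg ρ Y)
    (t : Tree E X) (ht : t.leaves.Nodup) (ha : a ∈ t.leaves) :
    evalTree ρ (Function.update q a (u + v)) t
      = evalTree ρ (Function.update q a u) t + evalTree ρ (Function.update q a v) t := by
  induction t with
  | leaf x =>
    simp only [Tree.leaves, List.mem_singleton] at ha
    subst ha
    simp [evalTree]
  | node e l r hl hr =>
    simp only [Tree.leaves, List.nodup_append', List.mem_append] at ht ha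
    obtain ⟨h1, h2, h3⟩ := ht
    have aux : ∀ s : Tree E X, a ∉ s.leaves → ∀ w w',
        evalTree ρ (Function.update q a w) s = evalTree ρ (Function.update q a w') s := by
      intro s hs w w'
      refine evalTree_congr ρ fun x hx => ?_
      have : x ≠ a := fun h => hs (h ▸ hx)
      simp [this]
    simp only [evalTree]
    rcases ha with ha | ha
    · rw [hl h1 ha, aux r (fun h => h3 ha h) (u + v) u, aux r (fun h => h3 ha h) v u]
      simp
    · rw [hr h2 ha, aux l (fun h => h3 h ha) (u + v) u, aux l (fun h => h3 h ha) v u]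
      simp

theorem evalTree_update_smul [DecidableEq X] (q : X → FreeAlg ρ Y) (a : X) (c : k)
    (u : FreeAlg ρ Y) (t : Tree E X) (ht : t.leaves.Nodup) (ha : a ∈ t.leaves) :
    evalTree ρ (Function.update q a (c • u)) t = c • evalTree ρ (Function.update q a u) t := by
  induction t with
  | leaf x =>
    simp only [Tree.leaves, List.mem_singleton] at ha
    subst ha
    simp [evalTree]
  | node e l r hl hr =>
    simp only [Tree.leaves, List.nodup_append', List.mem_append] at ht ha
    obtain ⟨h1, h2, h3⟩ := ht
    have aux : ∀ s : Tree E X, a ∉ s.leaves → ∀ w w',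
        evalTree ρ (Function.update q a w) s = evalTree ρ (Function.update q a w') s := by
      intro s hs w w'
      refine evalTree_congr ρ fun x hx => ?_
      have : x ≠ a := fun h => hs (h ▸ hx)
      simp [this]
    simp only [evalTree]
    rcases ha with ha | ha
    · rw [hl h1 ha, aux r (fun h => h3 ha h) (c • u) u]
      simp
    · rw [hr h2 ha, aux l (fun h => h3 h ha) (c • u) u]
      simp

/-- The multilinear part of the free algebra on `A`. -/
noncomputable def multilinearPart (A : Type) : Submodule k (FreeAlg ρ A) :=
  Submodule.span k (mon ρ '' {t | t.IsMultilinear})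

theorem mon_mem {A : Type} {t : Tree E A} (ht : t.IsMultilinear) :
    mon ρ t ∈ multilinearPart ρ A := Submodule.subset_span ⟨t, ht, rfl⟩

/-- The span of the trees without repeated labels whose set of labels is `s`. -/
noncomputable def supportedPart {A : Type} (s : Set A) : Submodule k (FreeAlg ρ A) :=
  Submodule.span k (mon ρ '' {t | t.leaves.Nodup ∧ ∀ x, x ∈ t.leaves ↔ x ∈ s})

theorem rename_mem_supportedPart {A B : Type} {f : A → B} (hf : Function.Injective f)
    {p : FreeAlg ρ A} (hp : p ∈ multilinearPart ρ A) :
    rename ρ f p ∈ supportedPart ρ (Set.range f) := by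
  have key : ∀ t : Tree E A, ∃ t' : Tree E B, t'.leaves = t.leaves.map f ∧
      rename ρ f (mon ρ t) = mon ρ t' := by
    intro t
    induction t with
    | leaf a => exact ⟨.leaf (f a), by simp [Tree.leaves], by simp [rename, evalTree]⟩
    | node e l r hl hr =>
      obtain ⟨l', h1, h2⟩ := hl
      obtain ⟨r', h3, h4⟩ := hr
      refine ⟨.node e l' r', by simp [Tree.leaves, h1, h3], ?_⟩
      rw [← op_mon, rename, subst_op, ← rename, h2, h4, op_mon]
  induction hp using Submodule.span_induction with
  | mem x hx =>
    obtain ⟨t, ht, rfl⟩ := hx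
    obtain ⟨t', h1, h2⟩ := key t
    rw [h2]
    refine Submodule.subset_span ⟨t', ⟨?_, ?_⟩, rfl⟩
    · rw [h1]; exact ht.1.map hf
    · intro x
      rw [h1, List.mem_map, Set.mem_range]
      exact ⟨fun ⟨a, _, h⟩ => ⟨a, h⟩, fun ⟨a, h⟩ => ⟨a, ht.2 a, h⟩⟩
  | zero => simp
  | add x y _ _ hx hy => rw [map_add]; exact add_mem hx hy
  | smul c x _ hx => rw [map_smul]; exact Submodule.smul_mem _ _ hx

theorem supportedPart_univ {A : Type} {s : Set A} (hs : s = Set.univ) :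
    supportedPart ρ s = multilinearPart ρ A := by
  subst hs
  simp [supportedPart, multilinearPart, Tree.IsMultilinear]

theorem op_mem_supportedPart {A : Type} {s t : Set A} (hst : Disjoint s t) (e : E)
    {p q : FreeAlg ρ A} (hp : p ∈ supportedPart ρ s) (hq : q ∈ supportedPart ρ t) :
    op ρ e p q ∈ supportedPart ρ (s ∪ t) := by
  induction hp using Submodule.span_induction with
  | mem x hx =>
    obtain ⟨l, hl, rfl⟩ := hx
    induction hq using Submodule.span_induction with
    | mem y hy =>
      obtain ⟨r, hr, rfl⟩ := hy
      rw [op_mon]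
      refine Submodule.subset_span ⟨_, ⟨?_, ?_⟩, rfl⟩
      · simp only [Tree.leaves, List.nodup_append']
        exact ⟨hl.1, hr.1, fun x h1 h2 =>
          Set.disjoint_left.1 hst ((hl.2 x).1 h1) ((hr.2 x).1 h2)⟩
      · intro x
        simp [Tree.leaves, hl.2, hr.2]
    | zero => simp
    | add x y _ _ hx hy => rw [map_add]; exact add_mem hx hy
    | smul c x _ hx => rw [map_smul]; exact Submodule.smul_mem _ _ hx
  | zero => simp
  | add x y _ _ hx hy => rw [map_add, LinearMap.add_apply]; exact add_mem hx hy
  | smul c x _ hx => rw [map_smul, LinearMap.smul_apply]; exact Submodule.smul_mem _ _ hx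

theorem subst_mem {A : Type} {B : A → Type} {p : FreeAlg ρ A} (hp : p ∈ multilinearPart ρ A)
    {q : ∀ a, FreeAlg ρ (B a)} (hq : ∀ a, q a ∈ multilinearPart ρ (B a)) :
    subst ρ (fun a => rename ρ (Sigma.mk a) (q a)) p ∈ multilinearPart ρ (Σ a, B a) := by
  have key : ∀ t : Tree E A, t.leaves.Nodup →
      evalTree ρ (fun a => rename ρ (Sigma.mk a) (q a)) t
        ∈ supportedPart ρ {x : Σ a, B a | x.1 ∈ t.leaves} := by
    intro t ht
    induction t with
    | leaf a =>
      have : {x : Σ a, B a | x.1 ∈ (Tree.leaf a : Tree E A).leaves} = Set.range (Sigma.mk a) := by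
        ext ⟨b, x⟩
        simp only [Tree.leaves, List.mem_singleton, Set.mem_ofPred_eq, Set.mem_range]
        constructor
        · rintro rfl; exact ⟨x, rfl⟩
        · rintro ⟨y, hy⟩; exact (congrArg Sigma.fst hy).symm
      rw [this]
      exact rename_mem_supportedPart ρ sigma_mk_injective (hq a)
    | node e l r hl hr =>
      simp only [Tree.leaves, List.nodup_append'] at ht
      have := op_mem_supportedPart ρ (s := {x : Σ a, B a | x.1 ∈ l.leaves})
        (t := {x : Σ a, B a | x.1 ∈ r.leaves})
        (Set.disjoint_left.2 fun x h1 h2 => ht.2.2 h1 h2) e (hl ht.1) (hr ht.2.1)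
      have hs : {x : Σ a, B a | x.1 ∈ (Tree.node e l r).leaves}
          = {x : Σ a, B a | x.1 ∈ l.leaves} ∪ {x : Σ a, B a | x.1 ∈ r.leaves} := by
        ext x
        simp [Tree.leaves]
      rw [hs]
      exact this
  induction hp using Submodule.span_induction with
  | mem x hx =>
    obtain ⟨t, ht, rfl⟩ := hx
    rw [subst_mon, ← supportedPart_univ ρ (s := {x : Σ a, B a | x.1 ∈ t.leaves})]
    · exact key t ht.1
    · ext x; simp [ht.2]
  | zero => simp
  | add x y _ _ hx hy => rw [map_add]; exact add_mem hx hy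
  | smul c x _ hx => rw [map_smul]; exact Submodule.smul_mem _ _ hx

theorem rename_mem {A B : Type} (σ : A ≃ B) {p : FreeAlg ρ A} (hp : p ∈ multilinearPart ρ A) :
    rename ρ σ p ∈ multilinearPart ρ B := by
  rw [← supportedPart_univ ρ σ.surjective.range_eq]
  exact rename_mem_supportedPart ρ σ.injective hp

/-- On multilinear elements, substitution is multilinear. -/
theorem subst_update_add {A : Type} [DecidableEq A] (q : A → FreeAlg ρ Y) (a : A)
    (u v : FreeAlg ρ Y) {p : FreeAlg ρ A} (hp : p ∈ multilinearPart ρ A) :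
    subst ρ (Function.update q a (u + v)) p
      = subst ρ (Function.update q a u) p + subst ρ (Function.update q a v) p := by
  induction hp using Submodule.span_induction with
  | mem x hx =>
    obtain ⟨t, ht, rfl⟩ := hx
    simpa using evalTree_update_add ρ q a u v t ht.1 (ht.2 a)
  | zero => simp
  | add x y _ _ hx hy => simp only [map_add, hx, hy]; abel
  | smul c x _ hx => simp only [map_smul, hx, smul_add]

theorem subst_update_smul {A : Type} [DecidableEq A] (q : A → FreeAlg ρ Y) (a : A) (c : k)
    (u : FreeAlg ρ Y) {p : FreeAlg ρ A} (hp : p ∈ multilinearPart ρ A) :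
    subst ρ (Function.update q a (c • u)) p = c • subst ρ (Function.update q a u) p := by
  induction hp using Submodule.span_induction with
  | mem x hx =>
    obtain ⟨t, ht, rfl⟩ := hx
    simpa using evalTree_update_smul ρ q a c u t ht.1 (ht.2 a)
  | zero => simp
  | add x y _ _ hx hy => simp only [map_add, hx, hy, smul_add]
  | smul d x _ hx => simp only [map_smul, hx]; rw [smul_comm]

theorem rename_update {A : Type} {B : A → Type} [DecidableEq A] (q : ∀ a, multilinearPart ρ (B a))
    (a : A) (u : multilinearPart ρ (B a)) :
    (fun b => rename ρ (Sigma.mk b) (Function.update q a u b : FreeAlg ρ (B b)))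
      = Function.update (fun b => rename ρ (Sigma.mk b) (q b : FreeAlg ρ (B b))) a
          (rename ρ (Sigma.mk a) (u : FreeAlg ρ (B a))) := by
  funext b
  by_cases h : b = a
  · subst h; simp
  · simp [h]

/-- Composition of multilinear elements: substitution, with disjoint sets of generators. -/
noncomputable def comp {A : Type} {B : A → Type} :
    multilinearPart ρ A →ₗ[k]
      MultilinearMap k (fun a => multilinearPart ρ (B a)) (multilinearPart ρ (Σ a, B a)) where
  toFun p :=
    { toFun := fun q => ⟨subst ρ (fun a => rename ρ (Sigma.mk a) (q a : FreeAlg ρ (B a))) p,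
        subst_mem ρ p.2 fun a => (q a).2⟩
      map_update_add' := fun q a u v => Subtype.ext (by
        simp only [Submodule.coe_add, rename_update, map_add]
        exact subst_update_add ρ _ a _ _ p.2)
      map_update_smul' := fun q a c u => Subtype.ext (by
        simp only [Submodule.coe_smul, rename_update, map_smul]
        exact subst_update_smul ρ _ a c _ p.2) }
  map_add' p p' := by ext q; simp
  map_smul' c p := by ext q; simp

end FreeAlg

open FreeAlg in
/-- The free operad on the `S₂`-module `E` of binary operations. -/
noncomputable def freeOperad : Operad k where
  obj A _ := multilinearPart ρ A
  relabel σ := (rename ρ σ).restrict fun _ hp => rename_mem ρ σ hp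
  one := ⟨mon ρ (.leaf 0), mon_mem ρ ⟨by simp [Tree.leaves], fun x => by
    simp [Tree.leaves, Subsingleton.elim x 0]⟩⟩
  comp := comp ρ
  relabel_refl p := Subtype.ext (subst_leaf ρ _)
  relabel_trans σ τ p := Subtype.ext (rename_rename ρ σ τ _).symm
  comp_relabel_left σ p q := Subtype.ext (by
    simp only [comp, LinearMap.coe_mk, AddHom.coe_mk, MultilinearMap.coe_mk,
      LinearMap.restrict_apply, subst_rename, rename_subst, rename_rename]
    rfl)
  comp_relabel_right τ p q := Subtype.ext (by
    simp only [comp, LinearMap.coe_mk, AddHom.coe_mk, MultilinearMap.coe_mk,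
      LinearMap.restrict_apply, rename_subst, rename_rename]
    rfl)
  one_comp p := Subtype.ext (by
    simp only [comp, LinearMap.coe_mk, AddHom.coe_mk, MultilinearMap.coe_mk,
      LinearMap.restrict_apply, subst_mon, evalTree, rename_rename]
    exact subst_leaf ρ _)
  comp_one p := Subtype.ext (by
    simp only [comp, LinearMap.coe_mk, AddHom.coe_mk, MultilinearMap.coe_mk,
      LinearMap.restrict_apply, rename_subst, rename_rename]
    simp only [rename, subst_mon, evalTree]
    exact subst_leaf ρ _)
  comp_assoc p q r := Subtype.ext (by
    simp only [comp, LinearMap.coe_mk, AddHom.coe_mk, MultilinearMap.coe_mk,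
      LinearMap.restrict_apply, rename_subst, subst_subst, subst_rename, rename_rename]
    rfl)

open FreeAlg in
/-- The inclusion of the generators: `e` as a binary operation in the free operad. -/
noncomputable def freeOperad.ι : E →ₗ[k] (freeOperad ρ).obj (Fin 2) where
  toFun e := ⟨mon ρ (.node e (.leaf 0) (.leaf 1)), mon_mem ρ (by
    constructor
    · simp [Tree.leaves]
    · intro x; fin_cases x <;> simp [Tree.leaves])⟩
  map_add' e f := Subtype.ext (mon_add ρ e f _ _)
  map_smul' c e := Subtype.ext (mon_smul ρ c e _ _)

end FreeAlg

/-! ### The components of a ternary operation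

With `(e ⊗ f)_c` the tree with root `e`, whose right input is `c` and whose left input is the
vertex `f` with inputs `c + 1`, `c + 2` (in cyclic order, so that the three types are `(0 1) 2`,
`(1 2) 0`, `(2 0) 1`), the ternary part of the free operad is the direct sum of three copies of
`E ⊗ E`. -/

section Components

variable {k : Type u} [Field k] {E : Type u} [AddCommGroup E] [Module k E]
  (ρ : Representation k (Equiv.Perm (Fin 2)) E)

namespace FreeAlg

variable {X : Type}

theorem tau_tau (e : E) : ρ tau (ρ tau e) = e := by
  rw [← Module.End.mul_apply, ← map_mul, Equiv.swap_mul_self, map_one, Module.End.one_apply]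

/-- The linear map with value `g₀ x` on a leaf `x`, and value
`h e [l] [r] + h (τ e) [r] [l]` on a tree with root `e` and subtrees `l`, `r`. -/
noncomputable def casesOn {N : Type*} [AddCommGroup N] [Module k N] (g₀ : X → N)
    (h : E →ₗ[k] FreeAlg ρ X →ₗ[k] FreeAlg ρ X →ₗ[k] N) : FreeAlg ρ X →ₗ[k] N :=
  desc ρ
    (fun
      | .leaf x => g₀ x
      | .node e l r => h e (mon ρ l) (mon ρ r) + h (ρ tau e) (mon ρ r) (mon ρ l))
    (fun x hx => by
      cases hx with
      | add e f l r => simp; abel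
      | smul c e l r => simp
      | symm e l r => simp [tau_tau, add_comm]
      | @left e r x hx =>
        have h0 := mk_rel ρ hx
        rw [mk_eq_linearCombination] at h0
        rw [Finsupp.linearCombination_mapDomain]
        have h2 := congrArg ((h e).flip (mon ρ r) + h (ρ tau e) (mon ρ r)) h0
        rw [Finsupp.apply_linearCombination, map_zero] at h2
        exact h2
      | @right e l x hx =>
        have h0 := mk_rel ρ hx
        rw [mk_eq_linearCombination] at h0
        rw [Finsupp.linearCombination_mapDomain]
        have h2 := congrArg (h e (mon ρ l) + (h (ρ tau e)).flip (mon ρ l)) h0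
        rw [Finsupp.apply_linearCombination, map_zero] at h2
        exact h2)

@[simp]
theorem casesOn_leaf {N : Type*} [AddCommGroup N] [Module k N] (g₀ : X → N)
    (h : E →ₗ[k] FreeAlg ρ X →ₗ[k] FreeAlg ρ X →ₗ[k] N) (x : X) :
    casesOn ρ g₀ h (mon ρ (.leaf x)) = g₀ x := desc_mon ..

@[simp]
theorem casesOn_node {N : Type*} [AddCommGroup N] [Module k N] (g₀ : X → N)
    (h : E →ₗ[k] FreeAlg ρ X →ₗ[k] FreeAlg ρ X →ₗ[k] N) (e : E) (l r : Tree E X) :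
    casesOn ρ g₀ h (mon ρ (.node e l r))
      = h e (mon ρ l) (mon ρ r) + h (ρ tau e) (mon ρ r) (mon ρ l) := desc_mon ..

theorem rename_op {Y : Type} (f : X → Y) (e : E) (x y : FreeAlg ρ X) :
    rename ρ f (op ρ e x y) = op ρ e (rename ρ f x) (rename ρ f y) := subst_op ..

theorem rename_leaf {Y : Type} (f : X → Y) (x : X) :
    rename ρ f (mon ρ (.leaf x)) = mon ρ (.leaf (f x)) := subst_mon ..

variable [DecidableEq X]

/-- The coefficient of the leaf `a`. -/
noncomputable def leafCoeff (a : X) : FreeAlg ρ X →ₗ[k] k :=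
  casesOn ρ (fun x => if x = a then 1 else 0) 0

/-- The element `f` of `E` such that the part with inputs `a`, `b` is `f (a, b)`. -/
noncomputable def vertexCoeff (a b : X) : FreeAlg ρ X →ₗ[k] E :=
  casesOn ρ (fun _ => 0)
    { toFun := fun e => LinearMap.mk₂ k (fun x y => (leafCoeff ρ a x * leafCoeff ρ b y) • e)
        (fun x x' y => by simp [add_mul, add_smul]) (fun c x y => by simp [mul_assoc, mul_smul])
        (fun x y y' => by simp [mul_add, add_smul])
        (fun c x y => by simp [mul_left_comm, mul_smul])
      map_add' := fun e f => by ext x y; simp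
      map_smul' := fun c e => LinearMap.ext₂ fun x y => smul_comm _ c e }

/-- The element of `E ⊗ E` that is the sum of the `e ⊗ f` over the terms `e (f (a, b), c)`. -/
noncomputable def tripleCoeff (a b c : X) : FreeAlg ρ X →ₗ[k] E ⊗[k] E :=
  casesOn ρ (fun _ => 0)
    { toFun := fun e => LinearMap.mk₂ k
        (fun x y => leafCoeff ρ c y • (e ⊗ₜ[k] vertexCoeff ρ a b x))
        (fun x x' y => by simp [TensorProduct.tmul_add])
        (fun d x y => by
          rw [map_smul, TensorProduct.tmul_smul]; exact smul_comm _ d _)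
        (fun x y y' => by simp [add_smul])
        (fun d x y => by simp [mul_smul])
      map_add' := fun e f => by ext x y; simp [TensorProduct.add_tmul]
      map_smul' := fun d e => LinearMap.ext₂ fun x y => smul_comm _ d (e ⊗ₜ[k] _) }

@[simp]
theorem leafCoeff_leaf (a x : X) : leafCoeff ρ a (mon ρ (.leaf x)) = if x = a then 1 else 0 := by
  simp [leafCoeff]

@[simp]
theorem leafCoeff_node (a : X) (e : E) (l r : Tree E X) :
    leafCoeff ρ a (mon ρ (.node e l r)) = 0 := by
  simp [leafCoeff]

@[simp]
theorem vertexCoeff_leaf (a b x : X) : vertexCoeff ρ a b (mon ρ (.leaf x)) = 0 := by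
  simp [vertexCoeff]

@[simp]
theorem vertexCoeff_node (a b : X) (e : E) (l r : Tree E X) :
    vertexCoeff ρ a b (mon ρ (.node e l r))
      = (leafCoeff ρ a (mon ρ l) * leafCoeff ρ b (mon ρ r)) • e
        + (leafCoeff ρ a (mon ρ r) * leafCoeff ρ b (mon ρ l)) • ρ tau e := by
  simp [vertexCoeff]

@[simp]
theorem tripleCoeff_leaf (a b c x : X) : tripleCoeff ρ a b c (mon ρ (.leaf x)) = 0 := by
  simp [tripleCoeff]

@[simp]
theorem tripleCoeff_node (a b c : X) (e : E) (l r : Tree E X) :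
    tripleCoeff ρ a b c (mon ρ (.node e l r))
      = leafCoeff ρ c (mon ρ r) • (e ⊗ₜ[k] vertexCoeff ρ a b (mon ρ l))
        + leafCoeff ρ c (mon ρ l) • (ρ tau e ⊗ₜ[k] vertexCoeff ρ a b (mon ρ r)) := by
  simp [tripleCoeff]

theorem leafCoeff_rename (σ : X ≃ X) (a : X) (x : FreeAlg ρ X) :
    leafCoeff ρ (σ a) (rename ρ σ x) = leafCoeff ρ a x := by
  have : leafCoeff ρ (σ a) ∘ₗ rename ρ σ = leafCoeff ρ a := hom_ext fun t => by
    cases t with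
    | leaf x => simp [rename, evalTree]
    | node e l r =>
      simp only [LinearMap.comp_apply, rename, subst_mon, evalTree]
      rw [← subst_mon, ← subst_mon]
      obtain ⟨x, hx⟩ : ∃ x, x = subst ρ (fun x => mon ρ (.leaf (σ x))) (mon ρ l) := ⟨_, rfl⟩
      obtain ⟨y, hy⟩ : ∃ y, y = subst ρ (fun x => mon ρ (.leaf (σ x))) (mon ρ r) := ⟨_, rfl⟩
      rw [← hx, ← hy, leafCoeff_node]
      have : (op ρ e).compr₂ (leafCoeff ρ (σ a)) = 0 :=
        hom_ext fun l => hom_ext fun r => by simp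
      exact LinearMap.congr_fun (LinearMap.congr_fun this x) y
  exact LinearMap.congr_fun this x

theorem vertexCoeff_op (a b : X) (e : E) (x y : FreeAlg ρ X) :
    vertexCoeff ρ a b (op ρ e x y) = (leafCoeff ρ a x * leafCoeff ρ b y) • e
        + (leafCoeff ρ a y * leafCoeff ρ b x) • ρ tau e := by
  obtain ⟨x, rfl⟩ := mk_surjective x
  obtain ⟨y, rfl⟩ := mk_surjective y
  rw [mk_eq_linearCombination, mk_eq_linearCombination]
  induction x using Finsupp.induction_linear with
  | zero => simp
  | add x x' hx hx' =>
    simp only [map_add, LinearMap.add_apply, hx, hx', add_mul, mul_add, add_smul]; abel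
  | single l c =>
    induction y using Finsupp.induction_linear with
    | zero => simp
    | add y y' hy hy' => simp only [map_add, hy, hy', add_mul, mul_add, add_smul]; abel
    | single r d =>
      simp only [Finsupp.linearCombination_single, map_smul, LinearMap.smul_apply, op_mon,
        vertexCoeff_node, smul_add, smul_smul, smul_eq_mul]
      ring_nf

theorem tripleCoeff_op (a b c : X) (e : E) (x y : FreeAlg ρ X) :
    tripleCoeff ρ a b c (op ρ e x y) = leafCoeff ρ c y • (e ⊗ₜ[k] vertexCoeff ρ a b x)
        + leafCoeff ρ c x • (ρ tau e ⊗ₜ[k] vertexCoeff ρ a b y) := by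
  obtain ⟨x, rfl⟩ := mk_surjective x
  obtain ⟨y, rfl⟩ := mk_surjective y
  rw [mk_eq_linearCombination, mk_eq_linearCombination]
  induction x using Finsupp.induction_linear with
  | zero => simp
  | add x x' hx hx' =>
    simp only [map_add, LinearMap.add_apply, hx, hx', TensorProduct.tmul_add, smul_add, add_smul]
    abel
  | single l d =>
    induction y using Finsupp.induction_linear with
    | zero => simp
    | add y y' hy hy' =>
      simp only [map_add, hy, hy', TensorProduct.tmul_add, smul_add, add_smul]
      abel
    | single r d' =>
      simp only [Finsupp.linearCombination_single, map_smul, LinearMap.smul_apply, op_mon,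
        tripleCoeff_node, smul_add, smul_smul, smul_eq_mul, TensorProduct.tmul_smul]
      ring_nf

theorem vertexCoeff_rename (σ : X ≃ X) (a b : X) (x : FreeAlg ρ X) :
    vertexCoeff ρ (σ a) (σ b) (rename ρ σ x) = vertexCoeff ρ a b x := by
  have : vertexCoeff ρ (σ a) (σ b) ∘ₗ rename ρ σ = vertexCoeff ρ a b := hom_ext fun t => by
    cases t with
    | leaf x => simp [rename_leaf]
    | node e l r =>
      simp only [LinearMap.comp_apply, ← op_mon, rename_op, vertexCoeff_op, leafCoeff_rename]
  exact LinearMap.congr_fun this x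

theorem tripleCoeff_rename (σ : X ≃ X) (a b c : X) (x : FreeAlg ρ X) :
    tripleCoeff ρ (σ a) (σ b) (σ c) (rename ρ σ x) = tripleCoeff ρ a b c x := by
  have : tripleCoeff ρ (σ a) (σ b) (σ c) ∘ₗ rename ρ σ = tripleCoeff ρ a b c :=
    hom_ext fun t => by
      cases t with
      | leaf x => simp [rename_leaf]
      | node e l r =>
        simp only [LinearMap.comp_apply, ← op_mon, rename_op, tripleCoeff_op, leafCoeff_rename,
          vertexCoeff_rename]
  exact LinearMap.congr_fun this x

theorem vertexCoeff_swap (a b : X) (x : FreeAlg ρ X) :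
    vertexCoeff ρ b a x = ρ tau (vertexCoeff ρ a b x) := by
  have : vertexCoeff ρ b a = ρ tau ∘ₗ vertexCoeff ρ a b := hom_ext fun t => by
    cases t with
    | leaf x => simp
    | node e l r =>
      simp only [LinearMap.comp_apply, vertexCoeff_node, map_add, map_smul, tau_tau]
      rw [add_comm, mul_comm, mul_comm (leafCoeff ρ b _)]
  exact LinearMap.congr_fun this x

theorem tripleCoeff_swap (a b c : X) (x : FreeAlg ρ X) :
    tripleCoeff ρ b a c x = (ρ tau).lTensor E (tripleCoeff ρ a b c x) := by
  have : tripleCoeff ρ b a c = (ρ tau).lTensor E ∘ₗ tripleCoeff ρ a b c := hom_ext fun t => by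
    cases t with
    | leaf x => simp
    | node e l r => simp [vertexCoeff_swap ρ a b]
  exact LinearMap.congr_fun this x

end FreeAlg

/-- The component of type `c` of a ternary operation of the free operad. -/
noncomputable def component (c : Fin 3) : (freeOperad ρ).obj (Fin 3) →ₗ[k] E ⊗[k] E :=
  FreeAlg.tripleCoeff ρ (c + 1) (c + 2) c ∘ₗ (FreeAlg.multilinearPart ρ (Fin 3)).subtype

theorem component_relabel (σ : Equiv.Perm (Fin 3)) (c : Fin 3) (x : (freeOperad ρ).obj (Fin 3)) :
    component ρ (σ c) ((freeOperad ρ).relabel σ x)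
      = if Equiv.Perm.sign σ = 1 then component ρ c x
        else (ρ tau).lTensor E (component ρ c x) := by
  have h1 : ∀ (σ : Equiv.Perm (Fin 3)) (c : Fin 3), Equiv.Perm.sign σ = 1 →
    σ c + 1 = σ (c + 1) ∧ σ c + 2 = σ (c + 2) := by decide
  have h2 : ∀ (σ : Equiv.Perm (Fin 3)) (c : Fin 3), Equiv.Perm.sign σ ≠ 1 →
    σ c + 1 = σ (c + 2) ∧ σ c + 2 = σ (c + 1) := by decide
  change FreeAlg.tripleCoeff ρ (σ c + 1) (σ c + 2) (σ c) (FreeAlg.rename ρ σ _) = _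
  split_ifs with h
  · rw [(h1 σ c h).1, (h1 σ c h).2, FreeAlg.tripleCoeff_rename]
    rfl
  · rw [(h2 σ c h).1, (h2 σ c h).2, FreeAlg.tripleCoeff_rename, FreeAlg.tripleCoeff_swap]
    rfl

end Components

/-! ### Quadratic operads and their Koszul duals -/

/-- The dual `E^∨ = E^* ⊗ sgn` of an `S₂`-module. -/
noncomputable def signDual {k : Type u} [Field k] {E : Type u} [AddCommGroup E] [Module k E]
    (ρ : Representation k (Equiv.Perm (Fin 2)) E) :
    Representation k (Equiv.Perm (Fin 2)) (Module.Dual k E) where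
  toFun g := ((Equiv.Perm.sign g : ℤ) : k) • ρ.dual g
  map_one' := by rw [map_one, map_one]; simp
  map_mul' g h := by
    rw [map_mul, map_mul, smul_mul_smul_comm]
    push_cast
    rfl

/-- The pairing between the ternary parts of the free operads on `E^∨` and on `E`:
`⟨(α ⊗ β)_c, (e ⊗ f)_d⟩` is `α e * β f` for `c = d` and `0` for `c ≠ d`. -/
noncomputable def pairing {k : Type u} [Field k] {E : Type u} [AddCommGroup E] [Module k E]
    (ρ : Representation k (Equiv.Perm (Fin 2)) E) :
    (freeOperad (signDual ρ)).obj (Fin 3) →ₗ[k] (freeOperad ρ).obj (Fin 3) →ₗ[k] k :=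
  ∑ c : Fin 3, (TensorProduct.dualDistrib k E E).compl₁₂
    (component (signDual ρ) c) (component ρ c)

theorem pairing_relabel {k : Type u} [Field k] {E : Type u} [AddCommGroup E] [Module k E]
    (ρ : Representation k (Equiv.Perm (Fin 2)) E) (σ : Equiv.Perm (Fin 3))
    (x : (freeOperad (signDual ρ)).obj (Fin 3)) (y : (freeOperad ρ).obj (Fin 3)) :
    pairing ρ ((freeOperad (signDual ρ)).relabel σ x) ((freeOperad ρ).relabel σ y)
      = ((Equiv.Perm.sign σ : ℤ) : k) * pairing ρ x y := by
  have key : ∀ (u : Module.Dual k E ⊗[k] Module.Dual k E) (v : E ⊗[k] E),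
      TensorProduct.dualDistrib k E E ((signDual ρ tau).lTensor _ u) ((ρ tau).lTensor _ v)
        = - TensorProduct.dualDistrib k E E u v := by
    intro u v
    induction u using TensorProduct.induction_on with
    | zero => simp
    | add u u' hu hu' => simp only [map_add, LinearMap.add_apply, hu, hu']; abel
    | tmul α β =>
      induction v using TensorProduct.induction_on with
      | zero => simp
      | add v v' hv hv' => simp only [map_add, hv, hv']; abel
      | tmul e f =>
        have : ρ (Equiv.swap 0 1) (ρ (Equiv.swap 0 1) f) = f := FreeAlg.tau_tau ρ f
        simp [signDual, Module.Dual.transpose_apply, this]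
  simp only [pairing, LinearMap.sum_apply, LinearMap.compl₁₂_apply]
  rw [← Equiv.sum_comp σ, Finset.mul_sum]
  refine Finset.sum_congr rfl fun c _ => ?_
  rw [component_relabel, component_relabel]
  split_ifs with h
  · simp [h]
  · have h' := (Int.units_eq_one_or (Equiv.Perm.sign σ)).resolve_left h
    rw [key, h']
    simp

/-- Quadratic data `(E, R)`: a finite-dimensional `S₂`-module `E` of generating binary operations
and an `S₃`-submodule `R` of the ternary part of the free operad on `E`. -/
structure QuadraticData (k : Type u) [Field k] where
  E : Type u
  [addCommGroup : AddCommGroup E]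
  [module : Module k E]
  [finite : Module.Finite k E]
  ρ : Representation k (Equiv.Perm (Fin 2)) E
  R : Submodule k ((freeOperad ρ).obj (Fin 3))
  relabel_mem : ∀ (σ : Equiv.Perm (Fin 3)) {x}, x ∈ R → (freeOperad ρ).relabel σ x ∈ R

attribute [instance] QuadraticData.addCommGroup QuadraticData.module QuadraticData.finite

namespace QuadraticData

variable {k : Type u} [Field k] (D : QuadraticData k)

/-- The quadratic operad `P(E, R)`: the free operad on `E` modulo the ideal generated by `R`. -/
noncomputable def operad : Operad k :=
  (freeOperad D.ρ).quotient ((freeOperad D.ρ).idealSpan D.R)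

/-- The binary operation of `P(E, R)` given by an element of `E`. -/
noncomputable def gen (e : D.E) : D.operad.obj (Fin 2) :=
  (((freeOperad D.ρ).idealSpan D.R).carrier (Fin 2)).mkQ (freeOperad.ι D.ρ e)

/-- The Koszul dual quadratic data `(E^∨, R^⊥)`; its operad is the Koszul dual operad
`P(E, R)^! = P(E^∨, R^⊥)`. -/
noncomputable def koszulDual : QuadraticData k where
  E := Module.Dual k D.E
  ρ := signDual D.ρ
  R := ⨅ y : D.R, LinearMap.ker ((pairing D.ρ).flip y)
  relabel_mem σ x hx := by
    simp only [Submodule.mem_iInf, LinearMap.mem_ker, LinearMap.flip_apply] at hx ⊢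
    intro y
    have h := pairing_relabel D.ρ σ x ((freeOperad D.ρ).relabel σ.symm y)
    rw [← (freeOperad D.ρ).relabel_trans, Equiv.symm_trans_self, (freeOperad D.ρ).relabel_refl,
      hx ⟨_, D.relabel_mem σ.symm y.2⟩, mul_zero] at h
    exact h

/-- The quadratic data with generators the free `S₂`-module on a finite set `X` of binary
operations, and relations the `S₃`-submodule generated by a set of ternary operations. -/
noncomputable def ofRelations (X : Type) [Finite X]
    (rels : Set ((freeOperad (Representation.free k (Equiv.Perm (Fin 2)) X)).obj (Fin 3))) :
    QuadraticData k where
  E := X →₀ MonoidAlgebra k (Equiv.Perm (Fin 2))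
  ρ := Representation.free k (Equiv.Perm (Fin 2)) X
  R := Submodule.span k {y | ∃ (σ : Equiv.Perm (Fin 3)), ∃ x ∈ rels, y = Operad.relabel _ σ x}
  relabel_mem σ x hx := by
    induction hx using Submodule.span_induction with
    | mem x hx =>
      obtain ⟨τ, x, hx, rfl⟩ := hx
      refine Submodule.subset_span ⟨τ.trans σ, x, hx, ?_⟩
      rw [Operad.relabel_trans]
    | zero => rw [map_zero]; exact zero_mem _
    | add x y _ _ hx hy => rw [map_add]; exact add_mem hx hy
    | smul c x _ hx => rw [map_smul]; exact Submodule.smul_mem _ _ hx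

end QuadraticData

/-! ### The operad on planar forests and the presentation of its dual -/

/-- The names of the two generating operations `m` and `↗`. -/
inductive Gen : Type
  | m
  | ne

instance : Finite Gen :=
  Finite.of_injective (fun g : Gen => match g with | .m => true | .ne => false) (by
    intro a b h
    cases a <;> cases b <;> simp_all)

section Nearrow

variable (k : Type u) [Field k]

/-- The free operad on the free `S₂`-module generated by `m` and `↗`. -/
noncomputable abbrev freeGen : Operad k :=
  freeOperad (Representation.free k (Equiv.Perm (Fin 2)) Gen)

/-- The generator `g` in the free `S₂`-module. -/
noncomputable abbrev basisElt (g : Gen) : Gen →₀ MonoidAlgebra k (Equiv.Perm (Fin 2)) :=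
  Finsupp.single g 1

/-- The element of the dual of the free `S₂`-module that takes the coefficient of the generator
`g`: it is `1` at `g`, and `0` at `τ g` and at the other generator and its image by `τ`. -/
noncomputable def dualElt (g : Gen) :
    Module.Dual k (Gen →₀ MonoidAlgebra k (Equiv.Perm (Fin 2))) where
  toFun v := (v g).coeff 1
  map_add' v w := by simp
  map_smul' c v := by simp

/-- The operation `m` of the free operad. -/
noncomputable def opM : (freeGen k).obj (Fin 2) := freeOperad.ι _ (basisElt k .m)

/-- The operation `↗` of the free operad. -/
noncomputable def opNE : (freeGen k).obj (Fin 2) := freeOperad.ι _ (basisElt k .ne)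

/-- The operad `P_↗`: generated by `m` and `↗` with the relations `↗∘(↗,I) = ↗∘(I,↗)`,
`↗∘(I,m) = m∘(↗,I)`, `m∘(m,I) = m∘(I,m)`. -/
noncomputable def nearrow : QuadraticData k :=
  .ofRelations Gen
    {(freeGen k).compLeft (opNE k) (opNE k) - (freeGen k).compRight (opNE k) (opNE k),
     (freeGen k).compRight (opNE k) (opM k) - (freeGen k).compLeft (opM k) (opNE k),
     (freeGen k).compLeft (opM k) (opM k) - (freeGen k).compRight (opM k) (opM k)}

/-- The operad generated by `m` and `↗` with the relations `↗∘(↗,I) = ↗∘(I,↗)`,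
`m∘(m,I) = m∘(I,m)`, `m∘(↗,I) = ↗∘(I,m)`, `↗∘(m,I) = 0`, `m∘(I,↗) = 0`. -/
noncomputable def nearrowDual : QuadraticData k :=
  .ofRelations Gen
    {(freeGen k).compLeft (opNE k) (opNE k) - (freeGen k).compRight (opNE k) (opNE k),
     (freeGen k).compLeft (opM k) (opM k) - (freeGen k).compRight (opM k) (opM k),
     (freeGen k).compLeft (opM k) (opNE k) - (freeGen k).compRight (opNE k) (opM k),
     (freeGen k).compLeft (opNE k) (opM k),
     (freeGen k).compRight (opM k) (opNE k)}

end Nearrow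

end Operads

/-! The free `S₂`-module on `m` and `↗` is isomorphic to its own sign-twisted dual: send each
generator `g` to the dual basis element `g^∨`, hence `τ g` to `-(τ g)^∨`. Extended to free operads,
this turns the canonical pairing into a bilinear form `genPairing` on the ternary part of a single
free operad, and the theorem becomes the statement that the orthogonal of the three relations of
`P_↗` is the span of the five relations of the dual, each taken with all its relabelings.

The ternary part has a basis of 48 combs: the left combs `g ∘ (h, I)` and the right combs `g ∘ (I,
h)` of generators, relabelled by `S₃`. In this basis the form is diagonal: a comb relabelled by `σ`
has square `sgn σ` if it is a left comb and `-sgn σ` if it is a right comb. The opposite signs are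
decisive: they make each of the three relations "left comb minus right comb" orthogonal to itself,
while `↗ ∘ (m, I)` and `m ∘ (I, ↗)` occur in no relation of `P_↗` and so belong to the orthogonal.
This gives one inclusion (`genPairing_eq_zero`).

For the other inclusion no dimension has to be computed. Modulo the five relations every ternary
operation is a combination of relabelled left combs `↗∘(↗,I)`, `m∘(↗,I)`, `m∘(m,I)`
(`nearrowDualSpan_sup_normal`), and these pair with the relabelled relations of `P_↗` through a
diagonal matrix with entries `±1` (`genPairing_nearrowNormal_nearrowRel`). A combination orthogonal
to all relations therefore has zero coefficients, in every characteristic.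

An equivariant isomorphism of generators that matches the ternary relations induces an isomorphism
of the quotient operads (`QuadraticData.exists_iso`). -/

namespace Operads

/-! ### Ideals and morphisms -/

/-- The preimage of an operadic ideal. -/
def Operad.Ideal.comap {k : Type u} [Field k] {P Q : Operad k} (F : P.Hom Q) (J : Q.Ideal) :
    P.Ideal where
  carrier A _ := (J.carrier A).comap (F.toFun A)
  relabel_mem σ p hp := by
    rw [Submodule.mem_comap] at hp ⊢
    rw [F.map_relabel]
    exact J.relabel_mem σ hp
  comp_mem_left q hp := by
    rw [Submodule.mem_comap] at hp ⊢
    rw [F.map_comp]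
    exact J.comp_mem_left _ hp
  comp_mem_right p q a hq := by
    rw [Submodule.mem_comap] at hq ⊢
    rw [F.map_comp]
    exact J.comp_mem_right _ a hq

theorem Operad.idealSpan_le {k : Type u} [Field k] {P : Operad k} {S : Set (P.obj (Fin 3))}
    {J : P.Ideal} (h : S ⊆ J.carrier (Fin 3)) (A : Type) [Finite A] :
    (P.idealSpan S).carrier A ≤ J.carrier A :=
  iInf_le (fun J : {J : P.Ideal // S ⊆ J.carrier (Fin 3)} => J.1.carrier A) ⟨J, h⟩

theorem Operad.subset_idealSpan {k : Type u} [Field k] {P : Operad k}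
    (S : Set (P.obj (Fin 3))) : S ⊆ (P.idealSpan S).carrier (Fin 3) := fun _ hx =>
  (Submodule.mem_iInf _).2 fun J => J.2 hx

/-- The preimage of the ideal generated by `T` is itself an ideal and contains `S`, so minimality of
the ideal generated by `S` applies. -/
theorem Operad.Hom.map_idealSpan_le {k : Type u} [Field k] {P Q : Operad k} (F : P.Hom Q)
    {S : Set (P.obj (Fin 3))} {T : Set (Q.obj (Fin 3))}
    (h : ∀ x ∈ S, F.toFun (Fin 3) x ∈ T) (A : Type) [Finite A] :
    (P.idealSpan S).carrier A ≤ ((Q.idealSpan T).carrier A).comap (F.toFun A) :=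
  Operad.idealSpan_le (J := (Q.idealSpan T).comap F)
    (fun x hx => Operad.subset_idealSpan T (h x hx)) A

/-- The morphism between quotients induced by a morphism of operads. -/
noncomputable def Operad.Hom.quotientMap {k : Type u} [Field k] {P Q : Operad k} (F : P.Hom Q)
    {I : P.Ideal} {J : Q.Ideal}
    (h : ∀ (A : Type) [Finite A], I.carrier A ≤ (J.carrier A).comap (F.toFun A)) :
    (P.quotient I).Hom (Q.quotient J) where
  toFun A _ := (I.carrier A).mapQ (J.carrier A) (F.toFun A) (h A)
  map_relabel {A B} _ _ σ p := by
    obtain ⟨p, rfl⟩ := Submodule.mkQ_surjective _ p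
    exact congrArg (J.carrier B).mkQ (F.map_relabel σ p)
  map_one := congrArg (J.carrier (Fin 1)).mkQ F.map_one
  map_comp {A B} _ _ p q := by
    obtain ⟨p, rfl⟩ := Submodule.mkQ_surjective _ p
    obtain ⟨q, rfl⟩ := I.exists_lift q
    -- Composition in a quotient is defined through chosen representatives; `quotComp_mk` on both
    -- sides replaces them by the representatives at hand.
    refine (congrArg _ (I.quotComp_mk p q)).trans ?_
    refine Eq.trans ?_ (J.quotComp_mk (F.toFun A p) fun a => F.toFun (B a) (q a)).symm
    exact congrArg (J.carrier _).mkQ (F.map_comp p q)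

/-! ### Functoriality of the free operad -/

/-- Apply a map to the decorations of the vertices. -/
def Tree.map {E E' : Type u} {X : Type} (φ : E → E') : Tree E X → Tree E' X
  | .leaf x => .leaf x
  | .node e l r => .node (φ e) (l.map φ) (r.map φ)

theorem Tree.leaves_map {E E' : Type u} {X : Type} (φ : E → E') (t : Tree E X) :
    (t.map φ).leaves = t.leaves := by
  induction t with
  | leaf x => rfl
  | node e l r hl hr => simp [Tree.map, Tree.leaves, hl, hr]

section Map

variable {k : Type u} [Field k] {E E' : Type u} [AddCommGroup E] [Module k E]
  [AddCommGroup E'] [Module k E']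
  {ρ : Representation k (Equiv.Perm (Fin 2)) E} {ρ' : Representation k (Equiv.Perm (Fin 2)) E'}

namespace FreeAlg

variable {X Y : Type} (φ : E →ₗ[k] E')

/-- Induction on how the relation is built: linearity of `φ` settles the relations `add` and `smul`,
equivariance the relation `symm`, and linearity of `op` in each argument carries a relation from a
subtree to the whole tree. -/
theorem linearCombination_mon_map (hφ : ∀ e, φ (ρ tau e) = ρ' tau (φ e))
    (x : Tree E X →₀ k) (hx : Rel ρ X x) :
    Finsupp.linearCombination k (fun t : Tree E X => mon ρ' (t.map φ)) x = 0 := by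
  induction hx with
  | add e f l r => simp [Tree.map, mon_add]
  | smul c e l r => simp [Tree.map, mon_smul]
  | symm e l r => simp [Tree.map, hφ, mon_symm]
  | @left e r x h ih =>
    rw [Finsupp.linearCombination_mapDomain]
    have h2 := congrArg ((op ρ' (φ e)).flip (mon ρ' (r.map φ))) ih
    rw [Finsupp.apply_linearCombination, map_zero] at h2
    simpa [Function.comp_def, Tree.map] using h2
  | @right e l x h ih =>
    rw [Finsupp.linearCombination_mapDomain]
    have h2 := congrArg (op ρ' (φ e) (mon ρ' (l.map φ))) ih
    rw [Finsupp.apply_linearCombination, map_zero] at h2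
    simpa [Function.comp_def, Tree.map] using h2

variable (hφ : ∀ e, φ (ρ tau e) = ρ' tau (φ e))

/-- The map of free algebras induced by a map of `S₂`-modules. -/
noncomputable def map (X : Type) : FreeAlg ρ X →ₗ[k] FreeAlg ρ' X :=
  desc ρ (fun t => mon ρ' (t.map φ)) (linearCombination_mon_map φ hφ)

theorem map_mon (t : Tree E X) : map φ hφ X (mon ρ t) = mon ρ' (t.map φ) := desc_mon ..

theorem map_evalTree (q : X → FreeAlg ρ Y) (t : Tree E X) :
    map φ hφ Y (evalTree ρ q t) = evalTree ρ' (fun x => map φ hφ Y (q x)) (t.map φ) := by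
  have map_op (e : E) (x y : FreeAlg ρ Y) :
      map φ hφ Y (op ρ e x y) = op ρ' (φ e) (map φ hφ Y x) (map φ hφ Y y) := by
    have : (op ρ e).compr₂ (map φ hφ Y) = (op ρ' (φ e)).compl₁₂ (map φ hφ Y) (map φ hφ Y) :=
      hom_ext fun l => hom_ext fun r => by simp [map_mon, Tree.map]
    simpa using LinearMap.congr_fun (LinearMap.congr_fun this x) y
  induction t with
  | leaf x => rfl
  | node e l r hl hr => simp only [evalTree, Tree.map, map_op, hl, hr]

theorem map_subst (q : X → FreeAlg ρ Y) (x : FreeAlg ρ X) :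
    map φ hφ Y (subst ρ q x) = subst ρ' (fun x => map φ hφ Y (q x)) (map φ hφ X x) := by
  have : map φ hφ Y ∘ₗ subst ρ q = subst ρ' (fun x => map φ hφ Y (q x)) ∘ₗ map φ hφ X :=
    hom_ext fun t => by simp [map_mon, map_evalTree]
  exact LinearMap.congr_fun this x

theorem map_rename (f : X → Y) (x : FreeAlg ρ X) :
    map φ hφ Y (rename ρ f x) = rename ρ' f (map φ hφ X x) := by
  simp [rename, map_subst, map_mon, Tree.map]

theorem map_mem {A : Type} {p : FreeAlg ρ A} (hp : p ∈ multilinearPart ρ A) :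
    map φ hφ A p ∈ multilinearPart ρ' A := by
  induction hp using Submodule.span_induction with
  | mem x hx =>
    obtain ⟨t, ht, rfl⟩ := hx
    rw [map_mon]
    refine mon_mem ρ' ?_
    rw [Set.mem_ofPred_eq] at ht
    rwa [Tree.IsMultilinear, Tree.leaves_map]
  | zero => simp
  | add x y _ _ hx hy => rw [map_add]; exact add_mem hx hy
  | smul c x _ hx => rw [map_smul]; exact Submodule.smul_mem _ _ hx

theorem map_map_of_leftInverse (ψ : E' →ₗ[k] E) (hψ : ∀ e, ψ (ρ' tau e) = ρ tau (ψ e))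
    (h : Function.LeftInverse ψ φ) (x : FreeAlg ρ X) : map ψ hψ X (map φ hφ X x) = x := by
  have key (t : Tree E X) : (t.map φ).map ψ = t := by
    induction t with
    | leaf x => rfl
    | node e l r hl hr => simp only [Tree.map, h e, hl, hr]
  have : map ψ hψ X ∘ₗ map φ hφ X = LinearMap.id :=
    hom_ext fun t => by simp [map_mon, key]
  exact LinearMap.congr_fun this x

end FreeAlg

/-- The morphism of free operads induced by a map of `S₂`-modules. -/
noncomputable def freeOperad.map (φ : E →ₗ[k] E') (hφ : ∀ e, φ (ρ tau e) = ρ' tau (φ e)) :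
    (freeOperad ρ).Hom (freeOperad ρ') where
  toFun A _ := (FreeAlg.map φ hφ A).restrict fun _ hp => FreeAlg.map_mem φ hφ hp
  map_relabel σ p := Subtype.ext (FreeAlg.map_rename φ hφ σ p.1)
  map_one := Subtype.ext (FreeAlg.map_mon φ hφ _)
  map_comp p q := Subtype.ext <| by
    refine (FreeAlg.map_subst φ hφ _ _).trans ?_
    simp only [FreeAlg.map_rename]
    rfl

theorem freeOperad.map_ι (φ : E →ₗ[k] E') (hφ : ∀ e, φ (ρ tau e) = ρ' tau (φ e)) (e : E) :
    (freeOperad.map φ hφ).toFun (Fin 2) (freeOperad.ι ρ e) = freeOperad.ι ρ' (φ e) :=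
  Subtype.ext (FreeAlg.map_mon φ hφ _)

theorem freeOperad.map_map_of_leftInverse (φ : E →ₗ[k] E')
    (hφ : ∀ e, φ (ρ tau e) = ρ' tau (φ e)) (ψ : E' →ₗ[k] E)
    (hψ : ∀ e, ψ (ρ' tau e) = ρ tau (ψ e)) (h : Function.LeftInverse ψ φ) {A : Type} [Finite A]
    (x : (freeOperad ρ).obj A) :
    (freeOperad.map ψ hψ).toFun A ((freeOperad.map φ hφ).toFun A x) = x :=
  Subtype.ext (FreeAlg.map_map_of_leftInverse φ hφ ψ hψ h x.1)

end Map

/-- An isomorphism of generators that matches the relations induces an isomorphism of quadratic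
operads. -/
theorem QuadraticData.exists_iso {k : Type u} [Field k] {D D' : QuadraticData k}
    (φ : D.E ≃ₗ[k] D'.E) (hφ : ∀ e, φ (D.ρ tau e) = D'.ρ tau (φ e))
    (hR : ∀ x, (freeOperad.map (ρ := D.ρ) (ρ' := D'.ρ) φ.toLinearMap hφ).toFun (Fin 3) x ∈ D'.R ↔
      x ∈ D.R) :
    ∃ Φ : D.operad.Hom D'.operad, Φ.IsIso ∧
      ∀ e, Φ.toFun (Fin 2) (D.gen e) = D'.gen (φ e) := by
  have hψ : ∀ e, φ.symm (D'.ρ tau e) = D.ρ tau (φ.symm e) := fun e => by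
    rw [LinearEquiv.symm_apply_eq, hφ, LinearEquiv.apply_symm_apply]
  let F := freeOperad.map (ρ := D.ρ) (ρ' := D'.ρ) φ.toLinearMap hφ
  let G := freeOperad.map (ρ := D'.ρ) (ρ' := D.ρ) φ.symm.toLinearMap hψ
  have hGF {A : Type} [Finite A] (x : (freeOperad D.ρ).obj A) :
      G.toFun A (F.toFun A x) = x :=
    freeOperad.map_map_of_leftInverse _ _ _ _ φ.symm_apply_apply x
  have hFG {A : Type} [Finite A] (x : (freeOperad D'.ρ).obj A) :
      F.toFun A (G.toFun A x) = x :=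
    freeOperad.map_map_of_leftInverse _ _ _ _ φ.apply_symm_apply x
  have hF := F.map_idealSpan_le (S := D.R) (T := D'.R) fun x hx => (hR x).2 hx
  -- The equivalence in `hR` is needed in both directions: it makes the inverse of `F` preserve
  -- relations as well.
  have hG := G.map_idealSpan_le (S := D'.R) (T := D.R) fun x hx => (hR _).1 (by rwa [hFG])
  refine ⟨F.quotientMap hF, fun A _ => Function.bijective_iff_has_inverse.2
    ⟨(G.quotientMap hG).toFun A, fun x => ?_, fun x => ?_⟩, fun e => ?_⟩
  · obtain ⟨x, rfl⟩ := Submodule.mkQ_surjective _ x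
    exact congrArg (Submodule.mkQ _) (hGF x)
  · obtain ⟨x, rfl⟩ := Submodule.mkQ_surjective _ x
    exact congrArg (Submodule.mkQ _) (hFG x)
  · exact congrArg (Submodule.mkQ _) (freeOperad.map_ι _ _ e)

/-! ### Ternary operations of free operads -/

theorem Operad.Hom.map_compLeft {k : Type u} [Field k] {P Q : Operad k} (F : P.Hom Q)
    (x y : P.obj (Fin 2)) :
    F.toFun (Fin 3) (P.compLeft x y) = Q.compLeft (F.toFun (Fin 2) x) (F.toFun (Fin 2) y) := by
  unfold Operad.compLeft
  simp only [F.map_relabel, F.map_comp]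
  congr 2
  funext i
  match i with
  | 0 => rfl
  | 1 => exact F.map_one

theorem Operad.Hom.map_compRight {k : Type u} [Field k] {P Q : Operad k} (F : P.Hom Q)
    (x y : P.obj (Fin 2)) :
    F.toFun (Fin 3) (P.compRight x y) = Q.compRight (F.toFun (Fin 2) x) (F.toFun (Fin 2) y) := by
  unfold Operad.compRight
  simp only [F.map_relabel, F.map_comp]
  congr 2
  funext i
  match i with
  | 0 => exact F.map_one
  | 1 => rfl

/-! ### Shapes of multilinear trees with three leaves -/

theorem Tree.one_le_length_leaves {E : Type u} {X : Type} (t : Tree E X) :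
    1 ≤ t.leaves.length := by
  induction t with
  | leaf x => simp [Tree.leaves]
  | node e l r hl hr => simp only [Tree.leaves, List.length_append]; omega

/-- A multilinear tree with three leaves is a left or a right comb. -/
theorem Tree.IsMultilinear.eq_comb {E : Type u} {t : Tree E (Fin 3)} (ht : t.IsMultilinear) :
    ∃ (σ : Equiv.Perm (Fin 3)) (e f : E),
      t = .node e (.node f (.leaf (σ 0)) (.leaf (σ 1))) (.leaf (σ 2)) ∨
      t = .node e (.leaf (σ 0)) (.node f (.leaf (σ 1)) (.leaf (σ 2))) := by
  have hlen : t.leaves.length = 3 := by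
    rw [← List.toFinset_card_of_nodup ht.1,
      Finset.eq_univ_iff_forall.2 fun x => List.mem_toFinset.2 (ht.2 x)]
    rfl
  -- Three distinct labels in reading order are the values of a permutation; distinctness is the
  -- first half of multilinearity.
  have perm (a b c : Fin 3) (h : [a, b, c].Nodup) :
      ∃ σ : Equiv.Perm (Fin 3), σ 0 = a ∧ σ 1 = b ∧ σ 2 = c := by
    revert a b c
    decide
  match t with
  | .leaf a => simp [Tree.leaves] at hlen
  | .node e (.leaf a) (.leaf b) => simp [Tree.leaves] at hlen
  | .node e (.leaf a) (.node f (.leaf b) (.leaf c)) =>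
    obtain ⟨σ, rfl, rfl, rfl⟩ := perm a b c ht.1
    exact ⟨σ, e, f, .inr rfl⟩
  | .node e (.node f (.leaf a) (.leaf b)) (.leaf c) =>
    obtain ⟨σ, rfl, rfl, rfl⟩ := perm a b c ht.1
    exact ⟨σ, e, f, .inl rfl⟩
  -- All remaining shapes have at least four leaves, since every subtree has at least one.
  | .node _ (.leaf _) (.node _ (.node _ l l') r) =>
    have := l.one_le_length_leaves
    have := l'.one_le_length_leaves
    have := r.one_le_length_leaves
    simp only [Tree.leaves, List.length_append, List.length_singleton] at hlen
    omega
  | .node _ (.leaf _) (.node _ (.leaf _) (.node _ l r)) =>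
    have := l.one_le_length_leaves
    have := r.one_le_length_leaves
    simp only [Tree.leaves, List.length_append, List.length_singleton] at hlen
    omega
  | .node _ (.node _ (.node _ l l') r) (.leaf _) =>
    have := l.one_le_length_leaves
    have := l'.one_le_length_leaves
    have := r.one_le_length_leaves
    simp only [Tree.leaves, List.length_append, List.length_singleton] at hlen
    omega
  | .node _ (.node _ (.leaf _) (.node _ l r)) (.leaf _) =>
    have := l.one_le_length_leaves
    have := r.one_le_length_leaves
    simp only [Tree.leaves, List.length_append, List.length_singleton] at hlen
    omega
  | .node _ (.node _ l l') (.node _ r r') =>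
    have := l.one_le_length_leaves
    have := l'.one_le_length_leaves
    have := r.one_le_length_leaves
    have := r'.one_le_length_leaves
    simp only [Tree.leaves, List.length_append] at hlen
    omega

/-! ### Combs as explicit trees and the action of `S₃` on them -/

section Ternary

variable {k : Type u} [Field k] {E : Type u} [AddCommGroup E] [Module k E]
  (ρ : Representation k (Equiv.Perm (Fin 2)) E)

open FreeAlg

/-- The renamings are arbitrary so that the statement unifies with the inclusions into the sigma
type and the bijection with `Fin 3` that occur in `compLeft`; there the resulting labels reduce to
`0`, `1`, `2` by computation. -/
theorem FreeAlg.rename_vertex_leaf {X X' Y Z : Type} (g : X → Y) (g' : X' → Y) (h : Y → Z)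
    (e f : E) (a b : X) (c : X') :
    rename ρ h (op ρ e (rename ρ g (mon ρ (.node f (.leaf a) (.leaf b))))
        (rename ρ g' (mon ρ (.leaf c))))
      = mon ρ (.node e (.node f (.leaf (h (g a))) (.leaf (h (g b)))) (.leaf (h (g' c)))) := by
  simp only [← op_mon, rename_op, rename_leaf]

theorem FreeAlg.rename_leaf_vertex {X X' Y Z : Type} (g : X → Y) (g' : X' → Y) (h : Y → Z)
    (e f : E) (a b : X) (c : X') :
    rename ρ h (op ρ e (rename ρ g' (mon ρ (.leaf c)))
        (rename ρ g (mon ρ (.node f (.leaf a) (.leaf b)))))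
      = mon ρ (.node e (.leaf (h (g' c))) (.node f (.leaf (h (g a))) (.leaf (h (g b))))) := by
  simp only [← op_mon, rename_op, rename_leaf]

theorem coe_compLeft (e f : E) :
    ((freeOperad ρ).compLeft (freeOperad.ι ρ e) (freeOperad.ι ρ f)).1
      = mon ρ (.node e (.node f (.leaf 0) (.leaf 1)) (.leaf 2)) :=
  (congrArg (rename ρ _) (subst_mon ρ _ _)).trans
    (rename_vertex_leaf ρ (X := Fin 2) (X' := Fin 1) _ _ _ e f 0 1 0)

theorem coe_compRight (e f : E) :
    ((freeOperad ρ).compRight (freeOperad.ι ρ e) (freeOperad.ι ρ f)).1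
      = mon ρ (.node e (.leaf 0) (.node f (.leaf 1) (.leaf 2))) :=
  (congrArg (rename ρ _) (subst_mon ρ _ _)).trans
    (rename_leaf_vertex ρ (X := Fin 2) (X' := Fin 1) _ _ _ e f 0 1 0)

theorem coe_relabel_compLeft (σ : Equiv.Perm (Fin 3)) (e f : E) :
    ((freeOperad ρ).relabel σ
        ((freeOperad ρ).compLeft (freeOperad.ι ρ e) (freeOperad.ι ρ f))).1
      = mon ρ (.node e (.node f (.leaf (σ 0)) (.leaf (σ 1))) (.leaf (σ 2))) := by
  refine (congrArg (rename ρ σ) (coe_compLeft ρ e f)).trans ?_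
  simp only [← op_mon, rename_op, rename_leaf]

theorem coe_relabel_compRight (σ : Equiv.Perm (Fin 3)) (e f : E) :
    ((freeOperad ρ).relabel σ
        ((freeOperad ρ).compRight (freeOperad.ι ρ e) (freeOperad.ι ρ f))).1
      = mon ρ (.node e (.leaf (σ 0)) (.node f (.leaf (σ 1)) (.leaf (σ 2)))) := by
  refine (congrArg (rename ρ σ) (coe_compRight ρ e f)).trans ?_
  simp only [← op_mon, rename_op, rename_leaf]

/-- The transposition at the root exchanges the two subtrees, so a left comb becomes a right comb,
and a cyclic rotation of the inputs restores the labels. -/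
theorem compLeft_tau_left (e f : E) :
    (freeOperad ρ).compLeft (freeOperad.ι ρ (ρ tau e)) (freeOperad.ι ρ f)
      = (freeOperad ρ).relabel (finRotate 3).symm
        ((freeOperad ρ).compRight (freeOperad.ι ρ e) (freeOperad.ι ρ f)) := by
  refine Subtype.ext ?_
  rw [coe_compLeft, coe_relabel_compRight, mon_symm]
  congr 1

theorem compRight_tau_left (e f : E) :
    (freeOperad ρ).compRight (freeOperad.ι ρ (ρ tau e)) (freeOperad.ι ρ f)
      = (freeOperad ρ).relabel (finRotate 3)
        ((freeOperad ρ).compLeft (freeOperad.ι ρ e) (freeOperad.ι ρ f)) := by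
  refine Subtype.ext ?_
  rw [coe_compRight, coe_relabel_compLeft, mon_symm]
  congr 1

/-- The transposition at the upper vertex keeps the shape of the comb and exchanges the two inputs
of that vertex. -/
theorem compLeft_tau_right (e f : E) :
    (freeOperad ρ).compLeft (freeOperad.ι ρ e) (freeOperad.ι ρ (ρ tau f))
      = (freeOperad ρ).relabel (Equiv.swap 0 1)
        ((freeOperad ρ).compLeft (freeOperad.ι ρ e) (freeOperad.ι ρ f)) := by
  refine Subtype.ext ?_
  -- Symmetry is available at the root of a tree only; splitting off the root by `op_mon` exposes
  -- the upper vertex.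
  rw [coe_compLeft, coe_relabel_compLeft, ← op_mon, mon_symm, op_mon]
  congr 1

theorem compRight_tau_right (e f : E) :
    (freeOperad ρ).compRight (freeOperad.ι ρ e) (freeOperad.ι ρ (ρ tau f))
      = (freeOperad ρ).relabel (Equiv.swap 1 2)
        ((freeOperad ρ).compRight (freeOperad.ι ρ e) (freeOperad.ι ρ f)) := by
  refine Subtype.ext ?_
  rw [coe_compRight, coe_relabel_compRight, ← op_mon, mon_symm, op_mon]
  congr 1

/-- The bilinear map `(e, f) ↦ e ∘ (f, I)`. -/
noncomputable def leftComb : E →ₗ[k] E →ₗ[k] (freeOperad ρ).obj (Fin 3) :=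
  LinearMap.mk₂ k
    (fun e f => (freeOperad ρ).compLeft (freeOperad.ι ρ e) (freeOperad.ι ρ f))
    (fun e e' f => Subtype.ext <| by
      refine Eq.trans ?_ (Submodule.coe_add _ _).symm
      simp only [coe_compLeft, mon_add])
    (fun c e f => Subtype.ext <| by
      refine Eq.trans ?_ (Submodule.coe_smul _ _).symm
      simp only [coe_compLeft, mon_smul])
    (fun e f f' => Subtype.ext <| by
      refine Eq.trans ?_ (Submodule.coe_add _ _).symm
      simp only [coe_compLeft]
      simp only [← op_mon, map_add, LinearMap.add_apply])
    (fun c e f => Subtype.ext <| by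
      refine Eq.trans ?_ (Submodule.coe_smul _ _).symm
      simp only [coe_compLeft]
      simp only [← op_mon, map_smul, LinearMap.smul_apply])

/-- The bilinear map `(e, f) ↦ e ∘ (I, f)`. -/
noncomputable def rightComb : E →ₗ[k] E →ₗ[k] (freeOperad ρ).obj (Fin 3) :=
  LinearMap.mk₂ k
    (fun e f => (freeOperad ρ).compRight (freeOperad.ι ρ e) (freeOperad.ι ρ f))
    (fun e e' f => Subtype.ext <| by
      refine Eq.trans ?_ (Submodule.coe_add _ _).symm
      simp only [coe_compRight, mon_add])
    (fun c e f => Subtype.ext <| by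
      refine Eq.trans ?_ (Submodule.coe_smul _ _).symm
      simp only [coe_compRight, mon_smul])
    (fun e f f' => Subtype.ext <| by
      refine Eq.trans ?_ (Submodule.coe_add _ _).symm
      simp only [coe_compRight]
      simp only [← op_mon, map_add, LinearMap.add_apply])
    (fun c e f => Subtype.ext <| by
      refine Eq.trans ?_ (Submodule.coe_smul _ _).symm
      simp only [coe_compRight]
      simp only [← op_mon, map_smul, LinearMap.smul_apply])

/-- A stable submodule of the ternary operations that contains all combs is everything. -/
theorem eq_top_of_comb_mem {T : Submodule k ((freeOperad ρ).obj (Fin 3))}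
    (hT : ∀ (σ : Equiv.Perm (Fin 3)), ∀ x ∈ T, (freeOperad ρ).relabel σ x ∈ T)
    (hl : ∀ e f, leftComb ρ e f ∈ T) (hr : ∀ e f, rightComb ρ e f ∈ T) : T = ⊤ := by
  rw [eq_top_iff]
  rintro ⟨x, hx⟩ -
  -- The multilinear part is a span inside the free algebra, so the spanning trees are tested there,
  -- in the image of `T`.
  suffices x ∈ T.map (multilinearPart ρ (Fin 3)).subtype by
    obtain ⟨y, hy, rfl⟩ := this
    exact hy
  refine Submodule.span_le.2 ?_ hx
  rintro _ ⟨t, ht, rfl⟩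
  obtain ⟨σ, e, f, rfl | rfl⟩ := Tree.IsMultilinear.eq_comb ht
  · exact ⟨_, hT σ _ (hl e f), coe_relabel_compLeft ρ σ e f⟩
  · exact ⟨_, hT σ _ (hr e f), coe_relabel_compRight ρ σ e f⟩

end Ternary

/-! ### The pairing on combs -/

section Pairing

variable {k : Type u} [Field k] {E : Type u} [AddCommGroup E] [Module k E]
  (ρ : Representation k (Equiv.Perm (Fin 2)) E)

open FreeAlg

theorem signDual_tau (α : Module.Dual k E) (e : E) : signDual ρ tau α e = -α (ρ tau e) := by
  simp [signDual, Module.Dual.transpose_apply]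

theorem component_relabel_leftComb (σ : Equiv.Perm (Fin 3)) (c : Fin 3) (e f : E) :
    component ρ c ((freeOperad ρ).relabel σ (leftComb ρ e f))
      = tripleCoeff ρ (c + 1) (c + 2) c
        (mon ρ (.node e (.node f (.leaf (σ 0)) (.leaf (σ 1))) (.leaf (σ 2)))) :=
  congrArg (tripleCoeff ρ (c + 1) (c + 2) c) (coe_relabel_compLeft ρ σ e f)

theorem component_relabel_rightComb (σ : Equiv.Perm (Fin 3)) (c : Fin 3) (e f : E) :
    component ρ c ((freeOperad ρ).relabel σ (rightComb ρ e f))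
      = tripleCoeff ρ (c + 1) (c + 2) c
        (mon ρ (.node e (.leaf (σ 0)) (.node f (.leaf (σ 1)) (.leaf (σ 2))))) :=
  congrArg (tripleCoeff ρ (c + 1) (c + 2) c) (coe_relabel_compRight ρ σ e f)

/-- The left comb `(0 1) 2` is already in the standard form of type `2`, so it has a single nonzero
component, `α ⊗ β`. -/
theorem pairing_leftComb (α β : Module.Dual k E) (y : (freeOperad ρ).obj (Fin 3)) :
    pairing ρ (leftComb (signDual ρ) α β) y
      = TensorProduct.dualDistrib k E E (α ⊗ₜ β) (component ρ 2 y) := by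
  have h (c : Fin 3) : component (signDual ρ) c (leftComb (signDual ρ) α β)
      = if c = 2 then α ⊗ₜ β else 0 := by
    refine (congrArg (tripleCoeff (signDual ρ) (c + 1) (c + 2) c)
      (coe_compLeft (signDual ρ) α β)).trans ?_
    fin_cases c <;> simp
  simp [pairing, Fin.sum_univ_three, h]

/-- The right comb `0 (1 2)` is of type `0`, but its vertex is on the right of the root; the
standard form has it on the left, which costs one transposition on the root decoration `α`. -/
theorem pairing_rightComb (α β : Module.Dual k E) (y : (freeOperad ρ).obj (Fin 3)) :
    pairing ρ (rightComb (signDual ρ) α β) y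
      = TensorProduct.dualDistrib k E E (signDual ρ tau α ⊗ₜ β) (component ρ 0 y) := by
  have h (c : Fin 3) : component (signDual ρ) c (rightComb (signDual ρ) α β)
      = if c = 0 then signDual ρ tau α ⊗ₜ β else 0 := by
    refine (congrArg (tripleCoeff (signDual ρ) (c + 1) (c + 2) c)
      (coe_compRight (signDual ρ) α β)).trans ?_
    fin_cases c <;> simp
  simp [pairing, Fin.sum_univ_three, h]

theorem perm_fin_three_eq_one_iff (σ : Equiv.Perm (Fin 3)) :
    σ = 1 ↔ σ 0 = 0 ∧ σ 1 = 1 ∧ σ 2 = 2 := by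
  revert σ
  decide

/-- The pairing of two left combs, when `β` vanishes on `τ f`. -/
theorem pairing_leftComb_leftComb (α β : Module.Dual k E) (e f : E) (hf : β (ρ tau f) = 0)
    (σ : Equiv.Perm (Fin 3)) :
    pairing ρ (leftComb (signDual ρ) α β) ((freeOperad ρ).relabel σ (leftComb ρ e f))
      = if σ = 1 then α e * β f else 0 := by
  rw [pairing_leftComb, component_relabel_leftComb]
  -- Component `2` of the relabelled comb is `e ⊗ f` if `σ = 1`, `e ⊗ τ f` if `σ` exchanges `0` and
  -- `1`, and zero otherwise; `hf` removes the second case.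
  simp only [tripleCoeff_node, vertexCoeff_node, leafCoeff_leaf, leafCoeff_node, zero_smul,
    add_zero, map_smul, TensorProduct.tmul_add, map_add, TensorProduct.tmul_smul,
    TensorProduct.dualDistrib_apply, hf, mul_zero, smul_zero, perm_fin_three_eq_one_iff]
  have h0 : (2 + 1 : Fin 3) = 0 := rfl
  have h1 : (2 + 2 : Fin 3) = 1 := rfl
  rw [h0, h1]
  split_ifs <;> simp_all

/-- The pairing of a left and a right comb, when `α` vanishes on `τ e`. -/
theorem pairing_leftComb_rightComb (α β : Module.Dual k E) (e f : E) (he : α (ρ tau e) = 0)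
    (σ : Equiv.Perm (Fin 3)) :
    pairing ρ (leftComb (signDual ρ) α β) ((freeOperad ρ).relabel σ (rightComb ρ e f)) = 0 := by
  rw [pairing_leftComb, component_relabel_rightComb]
  -- In standard form the right comb has root `τ e`, on which `α` vanishes.
  simp only [tripleCoeff_node, leafCoeff_node, zero_smul, zero_add, map_smul,
    TensorProduct.dualDistrib_apply, he, zero_mul, smul_zero]

/-- The pairing of a right and a left comb, when `α` vanishes on `τ e`. -/
theorem pairing_rightComb_leftComb (α β : Module.Dual k E) (e f : E) (he : α (ρ tau e) = 0)
    (σ : Equiv.Perm (Fin 3)) :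
    pairing ρ (rightComb (signDual ρ) α β) ((freeOperad ρ).relabel σ (leftComb ρ e f)) = 0 := by
  rw [pairing_rightComb, component_relabel_leftComb]
  simp only [tripleCoeff_node, leafCoeff_node, zero_smul, add_zero, map_smul,
    TensorProduct.dualDistrib_apply, signDual_tau, he, neg_zero, zero_mul, smul_zero]

/-- The pairing of two right combs, when `β` vanishes on `τ f`. -/
theorem pairing_rightComb_rightComb (α β : Module.Dual k E) (e f : E) (hf : β (ρ tau f) = 0)
    (σ : Equiv.Perm (Fin 3)) :
    pairing ρ (rightComb (signDual ρ) α β) ((freeOperad ρ).relabel σ (rightComb ρ e f))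
      = if σ = 1 then -(α e * β f) else 0 := by
  rw [pairing_rightComb, component_relabel_rightComb]
  -- Both roots are transposed, and the sign twist of the dual gives `(τ α) (τ e) = -α e`: this is
  -- the sign that separates right combs from left combs.
  simp only [tripleCoeff_node, vertexCoeff_node, leafCoeff_leaf, leafCoeff_node, zero_smul,
    zero_add, map_smul, TensorProduct.tmul_add, map_add, TensorProduct.tmul_smul, tau_tau,
    TensorProduct.dualDistrib_apply, signDual_tau, hf, mul_zero, smul_zero, add_zero,
    perm_fin_three_eq_one_iff]
  split_ifs <;> simp_all

end Pairing
/-! ### The free `S₂`-module on two generators and its dual -/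

instance : DecidableEq Gen := fun
  | .m, .m => isTrue rfl
  | .ne, .ne => isTrue rfl
  | .m, .ne => isFalse Gen.noConfusion
  | .ne, .m => isFalse Gen.noConfusion

section FreeModule

variable (k : Type u) [Field k]

/-- The free `S₂`-module generated by `m` and `↗`. -/
noncomputable abbrev genRep :
    Representation k (Equiv.Perm (Fin 2)) (Gen →₀ MonoidAlgebra k (Equiv.Perm (Fin 2))) :=
  Representation.free k (Equiv.Perm (Fin 2)) Gen

theorem genRep_basisElt (σ : Equiv.Perm (Fin 2)) (g : Gen) :
    genRep k σ (basisElt k g) = Finsupp.single g (MonoidAlgebra.single σ 1) := by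
  rw [basisElt, MonoidAlgebra.one_def, genRep, Representation.free_single_single, mul_one]

theorem dualElt_genRep_basisElt (g h : Gen) (σ : Equiv.Perm (Fin 2)) :
    dualElt k g (genRep k σ (basisElt k h)) = if g = h ∧ σ = 1 then 1 else 0 := by
  rw [genRep_basisElt]
  change (Finsupp.single h (MonoidAlgebra.single σ (1 : k)) g).coeff 1 = _
  rw [Finsupp.single_apply]
  by_cases hg : h = g
  · subst hg
    simp [MonoidAlgebra.coeff_single, Finsupp.single_apply]
  · simp [hg, Ne.symm hg]

theorem dualElt_basisElt (g h : Gen) :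
    dualElt k g (basisElt k h) = if g = h then 1 else 0 := by
  simpa using dualElt_genRep_basisElt k g h 1

theorem dualElt_tau_basisElt (g h : Gen) : dualElt k g (genRep k tau (basisElt k h)) = 0 := by
  rw [dualElt_genRep_basisElt, if_neg fun h => absurd h.2 (by decide)]

/-- Since `S₂ = {1, τ}`, the elements `g` and `τ g` for `g = m, ↗` span the free module. -/
theorem gen_induction {p : (Gen →₀ MonoidAlgebra k (Equiv.Perm (Fin 2))) → Prop}
    (hadd : ∀ v w, p v → p w → p (v + w)) (hsmul : ∀ (c : k) v, p v → p (c • v))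
    (hgen : ∀ g, p (basisElt k g)) (htau : ∀ g, p (genRep k tau (basisElt k g)))
    (v : Gen →₀ MonoidAlgebra k (Equiv.Perm (Fin 2))) : p v := by
  have hzero : p 0 := by simpa using hsmul 0 _ (hgen .m)
  have hperm (σ : Equiv.Perm (Fin 2)) : σ = 1 ∨ σ = tau := by
    revert σ
    decide
  have hsingle (g : Gen) (σ : Equiv.Perm (Fin 2)) (c : k) :
      p (Finsupp.single g (MonoidAlgebra.single σ c)) := by
    have : Finsupp.single g (MonoidAlgebra.single σ c)
        = c • genRep k σ (basisElt k g) := by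
      rw [genRep_basisElt, Finsupp.smul_single, MonoidAlgebra.smul_single, smul_eq_mul, mul_one]
    rw [this]
    refine hsmul c _ ?_
    rcases hperm σ with rfl | rfl
    · rw [map_one]
      exact hgen g
    · exact htau g
  induction v using Finsupp.induction_linear with
  | zero => exact hzero
  | add v w hv hw => exact hadd v w hv hw
  | single g a =>
    induction a using MonoidAlgebra.induction_linear with
    | zero => simpa using hzero
    | add a b ha hb => simpa using hadd _ _ ha hb
    | single σ c => exact hsingle g σ c

theorem genRep_tau_tau (v : Gen →₀ MonoidAlgebra k (Equiv.Perm (Fin 2))) :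
    genRep k tau (genRep k tau v) = v := FreeAlg.tau_tau _ v

/-- The `S₂`-equivariant map from the free `S₂`-module to its sign-twisted dual that sends each
generator to the dual basis element. -/
noncomputable def genToDual : (Gen →₀ MonoidAlgebra k (Equiv.Perm (Fin 2))) →ₗ[k]
    Module.Dual k (Gen →₀ MonoidAlgebra k (Equiv.Perm (Fin 2))) :=
  -- The second term for each generator sends `τ g` to minus the coefficient of `τ g`; equivariance
  -- for the sign-twisted action forces this sign.
  (dualElt k .m).smulRight (dualElt k .m)
    - (dualElt k .m ∘ₗ genRep k tau).smulRight (dualElt k .m ∘ₗ genRep k tau)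
    + ((dualElt k .ne).smulRight (dualElt k .ne)
    - (dualElt k .ne ∘ₗ genRep k tau).smulRight (dualElt k .ne ∘ₗ genRep k tau))

theorem genToDual_apply (v w : Gen →₀ MonoidAlgebra k (Equiv.Perm (Fin 2))) :
    genToDual k v w = dualElt k .m v * dualElt k .m w
      - dualElt k .m (genRep k tau v) * dualElt k .m (genRep k tau w)
      + (dualElt k .ne v * dualElt k .ne w
      - dualElt k .ne (genRep k tau v) * dualElt k .ne (genRep k tau w)) := rfl

theorem genToDual_basisElt (g : Gen) : genToDual k (basisElt k g) = dualElt k g := by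
  refine LinearMap.ext fun w => ?_
  simp only [genToDual_apply, dualElt_tau_basisElt, dualElt_basisElt]
  cases g <;> simp

theorem genToDual_tau (v : Gen →₀ MonoidAlgebra k (Equiv.Perm (Fin 2))) :
    genToDual k (genRep k tau v) = signDual (genRep k) tau (genToDual k v) := by
  refine LinearMap.ext fun w => ?_
  rw [signDual_tau, genToDual_apply, genToDual_apply, genRep_tau_tau, genRep_tau_tau]
  ring

/-- The bilinear form `genToDual k v w` is symmetric, so if it vanishes for a given `v` and all `w`,
pairing the generators with `v` and with `τ v` shows that all coordinates of `v` at `g` and `τ g`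
vanish. -/
theorem genToDual_injective : Function.Injective (genToDual k) := by
  have hflip (v w) : genToDual k v w = genToDual k w v := by
    simp only [genToDual_apply]
    ring
  refine (injective_iff_map_eq_zero _).2 fun v hv => ?_
  have h1 (g : Gen) : dualElt k g v = 0 := by
    rw [← genToDual_basisElt, ← hflip, hv, LinearMap.zero_apply]
  have h2 (g : Gen) : dualElt k g (genRep k tau v) = 0 := by
    rw [← genToDual_basisElt, ← hflip, genToDual_tau, hv, map_zero, LinearMap.zero_apply]
  have hcoeff (w : Gen →₀ MonoidAlgebra k (Equiv.Perm (Fin 2))) (g : Gen) :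
      dualElt k g (genRep k tau w) = (w g).coeff tau := by
    induction w using gen_induction with
    | hadd v w hv hw => simp [hv, hw]
    | hsmul c v hv => simp [hv]
    | hgen h =>
      rw [dualElt_tau_basisElt, basisElt, Finsupp.single_apply]
      split_ifs <;> simp [MonoidAlgebra.one_def, MonoidAlgebra.coeff_single]
    | htau h =>
      rw [genRep_tau_tau, dualElt_basisElt, genRep_basisElt, Finsupp.single_apply]
      by_cases hg : g = h
      · subst hg
        simp [MonoidAlgebra.coeff_single]
      · simp [hg, Ne.symm hg]
  ext g σ
  have hperm : σ = 1 ∨ σ = tau := by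
    revert σ
    decide
  rcases hperm with rfl | rfl
  · exact h1 g
  · exact (hcoeff v g).symm.trans (h2 g)

/-- The free `S₂`-module is isomorphic to its sign-twisted dual. -/
noncomputable def genDualEquiv : (Gen →₀ MonoidAlgebra k (Equiv.Perm (Fin 2))) ≃ₗ[k]
    Module.Dual k (Gen →₀ MonoidAlgebra k (Equiv.Perm (Fin 2))) :=
  (genToDual k).linearEquivOfInjective (genToDual_injective k) Subspace.dual_finrank_eq.symm

end FreeModule

/-! ### The orthogonal of the relations -/

theorem QuadraticData.mem_koszulDual_R {k : Type u} [Field k] (D : QuadraticData k)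
    (x : (freeOperad (signDual D.ρ)).obj (Fin 3)) :
    x ∈ D.koszulDual.R ↔ ∀ y ∈ D.R, pairing D.ρ x y = 0 := by
  change x ∈ (⨅ y : D.R, LinearMap.ker ((pairing D.ρ).flip y)) ↔ _
  simp [Submodule.mem_iInf]

section Relations

variable (k : Type u) [Field k]

/-- The left comb of two generators in the free operad. -/
noncomputable abbrev leftGen (g h : Gen) : (freeGen k).obj (Fin 3) :=
  leftComb (genRep k) (basisElt k g) (basisElt k h)

/-- The right comb of two generators in the free operad. -/
noncomputable abbrev rightGen (g h : Gen) : (freeGen k).obj (Fin 3) :=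
  rightComb (genRep k) (basisElt k g) (basisElt k h)

/-- The morphism of free operads given by the isomorphism of generators. -/
noncomputable abbrev freeGenToDual : (freeGen k).Hom (freeOperad (signDual (genRep k))) :=
  freeOperad.map (ρ := genRep k) (ρ' := signDual (genRep k)) (genDualEquiv k).toLinearMap
    (genToDual_tau k)

/-- The pairing of ternary operations transported to the free operad on `m` and `↗`. -/
noncomputable def genPairing :
    (freeGen k).obj (Fin 3) →ₗ[k] (freeGen k).obj (Fin 3) →ₗ[k] k :=
  pairing (genRep k) ∘ₗ (freeGenToDual k).toFun (Fin 3)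

/-! ### The Gram matrix of the combs of generators -/

theorem freeGenToDual_leftGen (g h : Gen) :
    (freeGenToDual k).toFun (Fin 3) (leftGen k g h)
      = leftComb (signDual (genRep k)) (dualElt k g) (dualElt k h) := by
  have h1 (g : Gen) : (freeGenToDual k).toFun (Fin 2) (freeOperad.ι _ (basisElt k g))
      = freeOperad.ι _ (dualElt k g) :=
    (freeOperad.map_ι _ _ _).trans (congrArg _ (genToDual_basisElt k g))
  exact ((freeGenToDual k).map_compLeft _ _).trans (congrArg₂ _ (h1 g) (h1 h))

theorem freeGenToDual_rightGen (g h : Gen) :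
    (freeGenToDual k).toFun (Fin 3) (rightGen k g h)
      = rightComb (signDual (genRep k)) (dualElt k g) (dualElt k h) := by
  have h1 (g : Gen) : (freeGenToDual k).toFun (Fin 2) (freeOperad.ι _ (basisElt k g))
      = freeOperad.ι _ (dualElt k g) :=
    (freeOperad.map_ι _ _ _).trans (congrArg _ (genToDual_basisElt k g))
  exact ((freeGenToDual k).map_compRight _ _).trans (congrArg₂ _ (h1 g) (h1 h))

/-- With the three lemmas that follow, this says that distinct relabelled combs of generators are
orthogonal to an unrelabelled one, and that left and right combs have opposite squares. A dual basis
element vanishes on every `τ g`, which is what the pairing of general combs requires. -/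
theorem genPairing_leftGen_leftGen (g h g' h' : Gen) (σ : Equiv.Perm (Fin 3)) :
    genPairing k (leftGen k g h) ((freeGen k).relabel σ (leftGen k g' h'))
      = if σ = 1 ∧ g = g' ∧ h = h' then 1 else 0 := by
  rw [genPairing, LinearMap.comp_apply, freeGenToDual_leftGen,
    pairing_leftComb_leftComb _ _ _ _ _ (dualElt_tau_basisElt k h h'), dualElt_basisElt,
    dualElt_basisElt, ite_mul, one_mul, zero_mul, ite_and, ite_and]

theorem genPairing_leftGen_rightGen (g h g' h' : Gen) (σ : Equiv.Perm (Fin 3)) :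
    genPairing k (leftGen k g h) ((freeGen k).relabel σ (rightGen k g' h')) = 0 := by
  rw [genPairing, LinearMap.comp_apply, freeGenToDual_leftGen,
    pairing_leftComb_rightComb _ _ _ _ _ (dualElt_tau_basisElt k g g')]

theorem genPairing_rightGen_leftGen (g h g' h' : Gen) (σ : Equiv.Perm (Fin 3)) :
    genPairing k (rightGen k g h) ((freeGen k).relabel σ (leftGen k g' h')) = 0 := by
  rw [genPairing, LinearMap.comp_apply, freeGenToDual_rightGen,
    pairing_rightComb_leftComb _ _ _ _ _ (dualElt_tau_basisElt k g g')]

theorem genPairing_rightGen_rightGen (g h g' h' : Gen) (σ : Equiv.Perm (Fin 3)) :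
    genPairing k (rightGen k g h) ((freeGen k).relabel σ (rightGen k g' h'))
      = if σ = 1 ∧ g = g' ∧ h = h' then -1 else 0 := by
  rw [genPairing, LinearMap.comp_apply, freeGenToDual_rightGen,
    pairing_rightComb_rightComb _ _ _ _ _ (dualElt_tau_basisElt k h h'), dualElt_basisElt,
    dualElt_basisElt]
  split_ifs <;> simp_all

/-- Twisted invariance moves both relabelings to the second argument, so pairings need to be
computed only against an unrelabelled first argument. -/
theorem genPairing_relabel (σ τ : Equiv.Perm (Fin 3)) (x y : (freeGen k).obj (Fin 3)) :
    genPairing k ((freeGen k).relabel σ x) ((freeGen k).relabel τ y)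
      = ((Equiv.Perm.sign σ : ℤ) : k)
        * genPairing k x ((freeGen k).relabel (τ.trans σ.symm) y) := by
  have h : (freeGen k).relabel τ y
      = (freeGen k).relabel σ ((freeGen k).relabel (τ.trans σ.symm) y) := by
    rw [← Operad.relabel_trans, Equiv.trans_assoc, Equiv.symm_trans_self, Equiv.trans_refl]
  rw [h, genPairing, LinearMap.comp_apply, (freeGenToDual k).map_relabel, pairing_relabel]
  rfl

/-- The relations of `P_↗`. -/
noncomputable def nearrowRel : Fin 3 → (freeGen k).obj (Fin 3) :=
  ![leftGen k .ne .ne - rightGen k .ne .ne,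
    rightGen k .ne .m - leftGen k .m .ne,
    leftGen k .m .m - rightGen k .m .m]

/-- The relations of the dual of `P_↗`. -/
noncomputable def nearrowDualRel : Fin 5 → (freeGen k).obj (Fin 3) :=
  ![leftGen k .ne .ne - rightGen k .ne .ne,
    leftGen k .m .m - rightGen k .m .m,
    leftGen k .m .ne - rightGen k .ne .m,
    leftGen k .ne .m,
    rightGen k .m .ne]

/-- Representatives of the ternary operations of the dual of `P_↗`. -/
noncomputable def nearrowNormal : Fin 3 → (freeGen k).obj (Fin 3) :=
  ![leftGen k .ne .ne, leftGen k .m .ne, leftGen k .m .m]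

/-- The relations of `P_↗` as a submodule of the ternary operations. -/
noncomputable def nearrowSpan : Submodule k ((freeGen k).obj (Fin 3)) :=
  Submodule.span k {y | ∃ (σ : Equiv.Perm (Fin 3)) (i : Fin 3),
    y = (freeGen k).relabel σ (nearrowRel k i)}

/-- The relations of the dual of `P_↗` as a submodule of the ternary operations. -/
noncomputable def nearrowDualSpan : Submodule k ((freeGen k).obj (Fin 3)) :=
  Submodule.span k {y | ∃ (σ : Equiv.Perm (Fin 3)) (i : Fin 5),
    y = (freeGen k).relabel σ (nearrowDualRel k i)}

/-! ### Orthogonality of the two families of relations -/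

theorem nearrow_R : (nearrow k).R = nearrowSpan k := by
  refine congrArg (Submodule.span k) (Set.ext fun y => exists_congr fun σ => ?_)
  simp only [Fin.exists_fin_succ, Set.mem_insert_iff, Set.mem_singleton_iff, exists_eq_or_imp,
    exists_eq_left, IsEmpty.exists_iff, or_false]
  rfl

theorem nearrowDual_R : (nearrowDual k).R = nearrowDualSpan k := by
  refine congrArg (Submodule.span k) (Set.ext fun y => exists_congr fun σ => ?_)
  simp only [Fin.exists_fin_succ, Set.mem_insert_iff, Set.mem_singleton_iff, exists_eq_or_imp,
    exists_eq_left, IsEmpty.exists_iff, or_false]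
  rfl

theorem nearrowDualSpan_relabel_mem (σ : Equiv.Perm (Fin 3)) {x : (freeGen k).obj (Fin 3)}
    (hx : x ∈ nearrowDualSpan k) : (freeGen k).relabel σ x ∈ nearrowDualSpan k := by
  suffices h : nearrowDualSpan k ≤ (nearrowDualSpan k).comap ((freeGen k).relabel σ) from h hx
  refine Submodule.span_le.2 ?_
  rintro _ ⟨τ, i, rfl⟩
  exact Submodule.subset_span ⟨τ.trans σ, i, ((freeGen k).relabel_trans τ σ _).symm⟩

theorem nearrowDualRel_mem (i : Fin 5) : nearrowDualRel k i ∈ nearrowDualSpan k := by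
  exact Submodule.subset_span ⟨1, i, ((freeGen k).relabel_refl _).symm⟩

/-- Two relations either share no comb up to relabeling, or have the same left comb and the same
right comb, whose contributions cancel because their squares have opposite signs. -/
theorem genPairing_nearrowDualRel_nearrowRel (i : Fin 5) (j : Fin 3) (σ : Equiv.Perm (Fin 3)) :
    genPairing k (nearrowDualRel k i) ((freeGen k).relabel σ (nearrowRel k j)) = 0 := by
  fin_cases i <;> fin_cases j <;>
    simp [nearrowDualRel, nearrowRel, genPairing_leftGen_leftGen, genPairing_leftGen_rightGen,
      genPairing_rightGen_leftGen, genPairing_rightGen_rightGen, -LinearMap.mk₂_apply]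
  all_goals split_ifs <;> simp

/-- Only the left comb of each relation contributes. The entry `-1` is the coefficient of `m ∘ (↗,
I)` in the second relation of `P_↗`. -/
theorem genPairing_nearrowNormal_nearrowRel (i j : Fin 3) (σ : Equiv.Perm (Fin 3)) :
    genPairing k (nearrowNormal k i) ((freeGen k).relabel σ (nearrowRel k j))
      = if σ = 1 ∧ i = j then ![1, -1, 1] i else 0 := by
  fin_cases i <;> fin_cases j <;>
    simp [nearrowNormal, nearrowRel, genPairing_leftGen_leftGen, genPairing_leftGen_rightGen,
      -LinearMap.mk₂_apply]
  split_ifs <;> simp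

theorem genPairing_eq_zero {x y : (freeGen k).obj (Fin 3)} (hx : x ∈ nearrowDualSpan k)
    (hy : y ∈ nearrowSpan k) : genPairing k x y = 0 := by
  induction hx using Submodule.span_induction with
  | mem x hx =>
    obtain ⟨σ, i, rfl⟩ := hx
    induction hy using Submodule.span_induction with
    | mem y hy =>
      obtain ⟨τ, j, rfl⟩ := hy
      rw [genPairing_relabel, genPairing_nearrowDualRel_nearrowRel, mul_zero]
    | zero => rw [map_zero]
    | add y z _ _ hy hz => rw [map_add, hy, hz, add_zero]
    | smul c y _ hy => rw [map_smul, hy, smul_zero]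
  | zero => rw [map_zero, LinearMap.zero_apply]
  | add x z _ _ hx hz => rw [map_add, LinearMap.add_apply, hx, hz, add_zero]
  | smul c x _ hx => rw [map_smul, LinearMap.smul_apply, hx, smul_zero]

/-- Every ternary operation is a combination of the representatives modulo the relations. -/
theorem nearrowDualSpan_sup_normal :
    nearrowDualSpan k ⊔ Submodule.span k (Set.range fun p : Equiv.Perm (Fin 3) × Fin 3 =>
      (freeGen k).relabel p.1 (nearrowNormal k p.2)) = ⊤ := by
  let N : Submodule k ((freeGen k).obj (Fin 3)) :=
    Submodule.span k (Set.range fun p : Equiv.Perm (Fin 3) × Fin 3 =>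
      (freeGen k).relabel p.1 (nearrowNormal k p.2))
  change nearrowDualSpan k ⊔ N = ⊤
  have hR (i : Fin 5) : nearrowDualRel k i ∈ nearrowDualSpan k ⊔ N :=
    Submodule.mem_sup_left (nearrowDualRel_mem k i)
  have hn (i : Fin 3) : nearrowNormal k i ∈ nearrowDualSpan k ⊔ N :=
    Submodule.mem_sup_right (Submodule.subset_span ⟨(1, i), (freeGen k).relabel_refl _⟩)
  have hstable (σ : Equiv.Perm (Fin 3)) (x) (hx : x ∈ nearrowDualSpan k ⊔ N) :
      (freeGen k).relabel σ x ∈ nearrowDualSpan k ⊔ N := by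
    obtain ⟨y, hy, z, hz, rfl⟩ := Submodule.mem_sup.1 hx
    rw [map_add]
    refine add_mem (Submodule.mem_sup_left (nearrowDualSpan_relabel_mem k σ hy))
      (Submodule.mem_sup_right ?_)
    suffices h : N ≤ N.comap ((freeGen k).relabel σ) from h hz
    refine Submodule.span_le.2 ?_
    rintro _ ⟨⟨τ, i⟩, rfl⟩
    exact Submodule.subset_span ⟨(τ.trans σ, i), (freeGen k).relabel_trans τ σ _⟩
  -- Of the four left combs, three are representatives and `↗ ∘ (m, I)` is a relation.
  have hleft (g h : Gen) : leftGen k g h ∈ nearrowDualSpan k ⊔ N := by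
    cases g <;> cases h
    · exact hn 2
    · exact hn 1
    · exact hR 3
    · exact hn 0
  -- Each right comb differs from a representative by a relation, except `m ∘ (I, ↗)`, which is
  -- itself a relation.
  have hright (g h : Gen) : rightGen k g h ∈ nearrowDualSpan k ⊔ N := by
    cases g <;> cases h
    · exact (Submodule.sub_mem_iff_right _ (hn 2)).1 (hR 1)
    · exact hR 4
    · exact (Submodule.sub_mem_iff_right _ (hn 1)).1 (hR 2)
    · exact (Submodule.sub_mem_iff_right _ (hn 0)).1 (hR 0)
  have hleft' (g : Gen) (f) : leftComb (genRep k) (basisElt k g) f ∈ nearrowDualSpan k ⊔ N := by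
    induction f using gen_induction with
    | hadd v w hv hw => rw [map_add]; exact add_mem hv hw
    | hsmul c v hv => rw [map_smul]; exact Submodule.smul_mem _ c hv
    | hgen h => exact hleft g h
    | htau h =>
      exact Set.mem_of_eq_of_mem (compLeft_tau_right (genRep k) (basisElt k g) (basisElt k h))
        (hstable _ _ (hleft g h))
  have hright' (g : Gen) (f) : rightComb (genRep k) (basisElt k g) f ∈ nearrowDualSpan k ⊔ N := by
    induction f using gen_induction with
    | hadd v w hv hw => rw [map_add]; exact add_mem hv hw
    | hsmul c v hv => rw [map_smul]; exact Submodule.smul_mem _ c hv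
    | hgen h => exact hright g h
    | htau h =>
      exact Set.mem_of_eq_of_mem (compRight_tau_right (genRep k) (basisElt k g) (basisElt k h))
        (hstable _ _ (hright g h))
  -- A transposition at the root exchanges left and right combs, so each of the two cases uses the
  -- other one for `τ g`.
  refine eq_top_of_comb_mem (genRep k) hstable (fun e f => ?_) fun e f => ?_
  · induction e using gen_induction with
    | hadd v w hv hw => rw [map_add]; exact add_mem hv hw
    | hsmul c v hv => rw [map_smul]; exact Submodule.smul_mem _ c hv
    | hgen g => exact hleft' g f
    | htau g =>
      exact Set.mem_of_eq_of_mem (compLeft_tau_left (genRep k) (basisElt k g) f)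
        (hstable _ _ (hright' g f))
  · induction e using gen_induction with
    | hadd v w hv hw => rw [map_add]; exact add_mem hv hw
    | hsmul c v hv => rw [map_smul]; exact Submodule.smul_mem _ c hv
    | hgen g => exact hright' g f
    | htau g =>
      exact Set.mem_of_eq_of_mem (compRight_tau_left (genRep k) (basisElt k g) f)
        (hstable _ _ (hleft' g f))

/-- The relations of the dual of `P_↗` span the orthogonal of the relations of `P_↗`. -/
theorem mem_nearrowDualSpan_iff (x : (freeGen k).obj (Fin 3)) :
    (∀ y ∈ nearrowSpan k, genPairing k x y = 0) ↔ x ∈ nearrowDualSpan k := by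
  refine ⟨fun h => ?_, fun hx y hy => genPairing_eq_zero k hx hy⟩
  obtain ⟨r, hr, n, hn, rfl⟩ := Submodule.mem_sup.1
    ((nearrowDualSpan_sup_normal k).symm ▸ Submodule.mem_top (x := x))
  obtain ⟨c, rfl⟩ := (Submodule.mem_span_range_iff_exists_fun k).1 hn
  -- Pairing with the relation indexed by `p` kills the part `r` and every representative except the
  -- one indexed by `p`, so the coefficient `c p` is isolated up to a sign.
  have hc (p : Equiv.Perm (Fin 3) × Fin 3) : c p = 0 := by
    have hmem : (freeGen k).relabel p.1 (nearrowRel k p.2) ∈ nearrowSpan k := by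
      exact Submodule.subset_span ⟨p.1, p.2, rfl⟩
    have h0 := h _ hmem
    rw [map_add, LinearMap.add_apply, genPairing_eq_zero k hr hmem, zero_add, map_sum,
      LinearMap.sum_apply, Finset.sum_eq_single p] at h0
    · rw [map_smul, LinearMap.smul_apply, genPairing_relabel, Equiv.self_trans_symm,
        genPairing_nearrowNormal_nearrowRel, if_pos ⟨rfl, rfl⟩, smul_eq_mul] at h0
      -- The matrix entry and the sign of the permutation are `±1`, hence nonzero in any
      -- characteristic.
      have hunit : (![1, -1, 1] : Fin 3 → k) p.2 ≠ 0 := by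
        generalize p.2 = i
        fin_cases i <;> simp
      have hsign : ((Equiv.Perm.sign p.1 : ℤ) : k) ≠ 0 := by
        rcases Int.units_eq_one_or (Equiv.Perm.sign p.1) with h | h <;> simp [h]
      simpa [hunit, hsign] using h0
    · intro q _ hq
      rw [map_smul, LinearMap.smul_apply, genPairing_relabel,
        genPairing_nearrowNormal_nearrowRel, if_neg, mul_zero, smul_zero]
      rintro ⟨h1, h2⟩
      refine hq (Prod.ext (Equiv.ext fun i => ?_) h2)
      have := Equiv.ext_iff.1 h1 i
      exact ((Equiv.symm_apply_eq _).1 this).symm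
    · exact fun h => absurd (Finset.mem_univ p) h
  simpa [hc] using hr

end Relations

end Operads

/-! ### The presentation of the Koszul dual -/

theorem mainTheorem6 (k : Type u) [Field k] :
    ∃ Φ : (Operads.nearrowDual k).operad.Hom (Operads.nearrow k).koszulDual.operad,
      Φ.IsIso ∧
      ∀ g : Operads.Gen,
        Φ.toFun (Fin 2) ((Operads.nearrowDual k).gen (Operads.basisElt k g))
          = (Operads.nearrow k).koszulDual.gen (Operads.dualElt k g) := by
  obtain ⟨Φ, hΦ, h⟩ := Operads.QuadraticData.exists_iso
    (D := Operads.nearrowDual k) (D' := (Operads.nearrow k).koszulDual)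
    (Operads.genDualEquiv k) (Operads.genToDual_tau k) fun x => by
      rw [Operads.nearrowDual_R]
      refine Iff.trans ?_ (Operads.mem_nearrowDualSpan_iff k x)
      refine (Operads.QuadraticData.mem_koszulDual_R (Operads.nearrow k) _).trans ?_
      rw [Operads.nearrow_R]
      -- By definition `genPairing` is the canonical pairing composed with the induced map of free
      -- operads.
      rfl
  refine ⟨Φ, hΦ, fun g => (h _).trans ?_⟩
  exact congrArg _ (Operads.genToDual_basisElt k g)
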